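/- Let $n\ge 3$ and $\eta_{\mu\nu}=\mathrm{diag}(-1,1,\dots,1)$. Consider the fields $h_{\mu\nu}=h_{\nu\mu}$, the ghosts $C_\mu,\xi$ and the antifields $h^{*\mu\nu}=h^{*\nu\mu},C^{*\mu},\xi^*$ (collectively $\Phi^*$), together with all their formal derivatives as independent variables; $C_\mu,\xi,h^{*\mu\nu}$ and their derivatives anticommute, $h_{\mu\nu},C^{*\mu},\xi^*$ and their derivatives commute with everything. A local function is a real polynomial in these variables (with no explicit dependence on $x^\mu$), except that its coefficients may be arbitrary smooth functions of the undifferentiated $h_{\mu\nu}$. Let $\gamma$ be the odd derivation of the algebra of local functions that commutes with the total derivatives $\partial_\mu$ and satisfies $$\gamma h_{\mu\nu}=\partial_\mu C_\nu+\partial_\nu C_\mu+2\eta_{\mu\nu}\xi,\qquad \gamma C_\mu=\gamma\xi=0,\qquad \gamma h^{*\mu\nu}=\gamma C^{*\mu}=\gamma\xi^*=0 .$$ Let $$\mathcal R_{\alpha\beta\mu\nu}=-\tfrac12(\partial_\alpha\partial_\mu h_{\beta\nu}+\partial_\beta\partial_\nu h_{\alpha\mu}-\partial_\alpha\partial_\nu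 h_{\beta\mu}-\partial_\beta\partial_\mu h_{\alpha\nu}),\quad \mathcal R_{\mu\nu}=\eta^{\alpha\lambda}\mathcal R_{\lambda\mu\alpha\nu},\quad \mathcal R=\eta^{\mu\nu}\mathcal R_{\mu\nu}$$ be the linearized Riemann tensor, Ricci tensor and scalar curvature, $$\mathcal W_{\alpha\beta\gamma\delta}=\mathcal R_{\alpha\beta\gamma\delta}-\tfrac1{n-2}(\eta_{\alpha\gamma}\mathcal R_{\delta\beta}-\eta_{\alpha\delta}\mathcal R_{\gamma\beta}-\eta_{\beta\gamma}\mathcal R_{\delta\alpha}+\eta_{\beta\delta}\mathcal R_{\gamma\alpha})+\tfrac{1}{(n-2)(n-1)}\mathcal R(\eta_{\alpha\gamma}\eta_{\delta\beta}-\eta_{\alpha\delta}\eta_{\gamma\beta})$$ the linearized Weyl tensor, and $$\mathcal C_{\alpha\beta\mu}=\partial_\mu\mathcal K_{\beta\alpha}-\partial_\beta\mathcal K_{\mu\alpha},\qquad \mathcal K_{\mu\nu}=\tfrac1{n-2}\bigl(\mathcal R_{\mu\nu}-\tfrac1{2(n-1)}\eta_{\mu\nu}\mathcal R\bigr)$$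 the linearized Cotton tensor. Then $\gamma^2=0$, and: (i) if $n\ge4$, let $S$ be the algebra of all polynomials in the components $\mathcal W_{\alpha\beta\gamma\delta}$ and $\Phi^*$, all derivatives of these, and the ghosts $C_\mu$, $\partial_{[\mu}C_{\nu]}=\tfrac12(\partial_\mu C_\nu-\partial_\nu C_\mu)$, $\xi$, $\partial_\mu\xi$. Every element of $S$ is a $\gamma$-cocycle, and sending an element of $S$ to its cohomology class is a linear isomorphism from $S$ onto $H(\gamma)=\mathrm{Ker}\,\gamma/\mathrm{Im}\,\gamma$; (ii) if $n=3$, the same holds with $\mathcal W_{\alpha\beta\gamma\delta}$ and its derivatives replaced by $\mathcal C_{\alpha\beta\mu}$ and its derivatives. Both statements also hold when local functions are required to be polynomial in the undifferentiated $h_{\mu\nu}$ as well. -/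

import Mathlib

open scoped TensorProduct ContDiff

noncomputable section

namespace LinWeyl

/-! ### Jets and total derivatives -/

/-- The jet of a field: its value at a multi-index `J = {α₁, …, α_k}` is the (symmetric) iterated
total derivative `∂_{α₁} ⋯ ∂_{α_k}` of the field; its value at `0` is the field itself. -/
abbrev Jet (n : ℕ) (A : Type) : Type := Multiset (Fin n) → A

/-- The jet of the total derivative `∂_α F` of a field with jet `F`. -/
def pd {n : ℕ} {A : Type} (α : Fin n) (F : Jet n A) : Jet n A := fun J => F (α ::ₘ J)

theorem pd_apply {n : ℕ} {A : Type} (α : Fin n) (F : Jet n A) (J : Multiset (Fin n)) :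
    pd α F J = F (α ::ₘ J) := rfl

/-- The flat metric `diag(-1, 1, …, 1)`. It is its own inverse, so it also plays `η^{μν}`. -/
def eta {n : ℕ} (μ ν : Fin n) : ℝ :=
  if μ = ν then (if (μ : ℕ) = 0 then -1 else 1) else 0

theorem eta_comm {n : ℕ} (μ ν : Fin n) : eta μ ν = eta ν μ := by
  unfold eta
  by_cases h : μ = ν
  · subst h; rfl
  · rw [if_neg h, if_neg (Ne.symm h)]

/-! ### The algebra of local functions -/

/-- The commuting jet variables other than the undifferentiated `h_{μν}`: the proper derivatives
`∂_J h_{μν}` (`J ≠ 0`; unordered index pairs since `h` is symmetric), and the antifields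
`∂_J C^{*μ}`, `∂_J ξ^*` of antifield number 2. -/
inductive EvenVar (n : ℕ) : Type
  | h (J : Multiset (Fin n)) (hJ : J ≠ 0) (p : Sym2 (Fin n)) : EvenVar n
  | Cstar (J : Multiset (Fin n)) (μ : Fin n) : EvenVar n
  | xistar (J : Multiset (Fin n)) : EvenVar n

/-- The anticommuting jet variables: the ghosts `∂_J C_μ`, `∂_J ξ` and the antifields
`∂_J h^{*μν}`. -/
inductive OddVar (n : ℕ) : Type
  | C (J : Multiset (Fin n)) (μ : Fin n) : OddVar n
  | xi (J : Multiset (Fin n)) : OddVar n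
  | hstar (J : Multiset (Fin n)) (p : Sym2 (Fin n)) : OddVar n

/-- Grassmann polynomials in the anticommuting variables. -/
abbrev OddPoly (n : ℕ) : Type := ExteriorAlgebra ℝ (OddVar n →₀ ℝ)

/-- Polynomials in all jet variables other than the undifferentiated `h_{μν}`. -/
abbrev JetPoly (n : ℕ) : Type := MvPolynomial (EvenVar n) ℝ ⊗[ℝ] OddPoly n

/-- Local functions: polynomials in all jet variables other than the undifferentiated `h_{μν}`,
whose coefficients lie in an algebra `R` of functions of the undifferentiated `h_{μν}`. -/
abbrev LocalFunction (n : ℕ) (R : Type) [CommRing R] [Algebra ℝ R] : Type :=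
  R ⊗[ℝ] JetPoly n

/-! ### The two algebras of functions of the undifferentiated field -/

/-- Polynomial functions of the undifferentiated `h_{μν}`. -/
abbrev PolyCoeff (n : ℕ) : Type := MvPolynomial (Sym2 (Fin n)) ℝ

/-- The coordinates `h_{μν}` as polynomials. -/
def polyCoord (n : ℕ) (p : Sym2 (Fin n)) : PolyCoeff n := MvPolynomial.X p

/-- The derivations `∂/∂h_{μν}` (each unordered pair is one independent variable). -/
def polyPartial (n : ℕ) (p : Sym2 (Fin n)) : Derivation ℝ (PolyCoeff n) (PolyCoeff n) :=
  (MvPolynomial.pderiv p : Derivation ℝ (MvPolynomial (Sym2 (Fin n)) ℝ) _)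

/-- Smooth functions of the undifferentiated `h_{μν}`. -/
def smoothFunctions (n : ℕ) : Subalgebra ℝ ((Sym2 (Fin n) → ℝ) → ℝ) where
  carrier := {f | ContDiff ℝ ∞ f}
  mul_mem' := by
    intro f g hf hg
    rw [Set.mem_ofPred_eq] at hf hg ⊢
    exact hf.mul hg
  add_mem' := by
    intro f g hf hg
    rw [Set.mem_ofPred_eq] at hf hg ⊢
    exact hf.add hg
  algebraMap_mem' := by
    intro c
    rw [Set.mem_ofPred_eq]
    exact (contDiff_const : ContDiff ℝ ∞ fun _ : Sym2 (Fin n) → ℝ => c)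

theorem mem_smoothFunctions {n : ℕ} {f : (Sym2 (Fin n) → ℝ) → ℝ} :
    f ∈ smoothFunctions n ↔ ContDiff ℝ ∞ f := Iff.rfl

/-- The algebra of smooth functions of the undifferentiated `h_{μν}`. -/
abbrev SmoothCoeff (n : ℕ) : Type := smoothFunctions n

/-- The coordinates `h_{μν}` as smooth functions. -/
def smoothCoord (n : ℕ) (p : Sym2 (Fin n)) : SmoothCoeff n :=
  ⟨fun x => x p, mem_smoothFunctions.2 (contDiff_apply ℝ ℝ p)⟩

theorem SmoothCoeff.differentiableAt {n : ℕ} (f : SmoothCoeff n) (x : Sym2 (Fin n) → ℝ) :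
    DifferentiableAt ℝ f.1 x :=
  ((mem_smoothFunctions.1 f.2).differentiable (by simp)).differentiableAt

/-- The derivations `∂/∂h_{μν}` (each unordered pair is one independent variable). -/
def smoothPartial (n : ℕ) (p : Sym2 (Fin n)) : Derivation ℝ (SmoothCoeff n) (SmoothCoeff n) :=
  Derivation.mk'
    { toFun := fun f => ⟨fun x => fderiv ℝ f.1 x (Pi.single p 1),
        mem_smoothFunctions.2 (((mem_smoothFunctions.1 f.2).fderiv_right
          (m := ∞) (by simp)).clm_apply contDiff_const)⟩
      map_add' := fun f g => by
        apply Subtype.ext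
        funext x
        have h := fderiv_add (f.differentiableAt x) (g.differentiableAt x)
        exact congrArg (fun L => L (Pi.single p 1)) h
      map_smul' := fun c f => by
        apply Subtype.ext
        funext x
        have h := fderiv_const_smul (f.differentiableAt x) c
        exact congrArg (fun L => L (Pi.single p 1)) h }
    (fun f g => by
      apply Subtype.ext
      funext x
      have h := fderiv_mul (f.differentiableAt x) (g.differentiableAt x)
      exact congrArg (fun L => L (Pi.single p 1)) h)

/-! ### The differential `γ` -/

/-- The jet of the ghost `C_μ`. -/
def oddC {n : ℕ} (μ : Fin n) : Jet n (OddPoly n) :=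
  fun J => ExteriorAlgebra.ι ℝ (Finsupp.single (OddVar.C J μ) 1)

/-- The jet of the ghost `ξ`. -/
def oddXi {n : ℕ} : Jet n (OddPoly n) :=
  fun J => ExteriorAlgebra.ι ℝ (Finsupp.single (OddVar.xi J) 1)

/-- The jet of `h^{*μν}`. -/
def oddHstar {n : ℕ} (μ ν : Fin n) : Jet n (OddPoly n) :=
  fun J => ExteriorAlgebra.ι ℝ (Finsupp.single (OddVar.hstar J s(μ, ν)) 1)

/-- The jet of `γ h_{μν} = ∂_μ C_ν + ∂_ν C_μ + 2 η_{μν} ξ`. -/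
def gammaH {n : ℕ} (μ ν : Fin n) : Jet n (OddPoly n) :=
  pd μ (oddC ν) + pd ν (oddC μ) + (2 * eta μ ν) • oddXi

/-- `gammaH` as a function of the unordered index pair. -/
def gammaHSym {n : ℕ} : Sym2 (Fin n) → Jet n (OddPoly n) :=
  Sym2.lift ⟨gammaH, fun μ ν => by
    unfold gammaH
    rw [eta_comm μ ν, add_comm (pd μ (oddC ν))]⟩

/-- The value of `γ` on the commuting jet variables: `γ (∂_J h_{μν}) = ∂_J (γ h_{μν})`, and the
antifields are annihilated. -/
def gammaEvenVar {n : ℕ} : EvenVar n → JetPoly n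
  | .h J _ p => 1 ⊗ₜ gammaHSym p J
  | .Cstar _ _ => 0
  | .xistar _ => 0

/-- `γ` on polynomials in the jet variables other than the undifferentiated `h_{μν}`: the ghosts
and the antifields `h^*` are annihilated, so `γ (P w) = (γ P) w` for a Grassmann polynomial `w`. -/
def gammaJet (n : ℕ) : JetPoly n →ₗ[ℝ] JetPoly n :=
  TensorProduct.lift <|
    (LinearMap.mul ℝ (JetPoly n)).compl₁₂
      (MvPolynomial.mkDerivation ℝ (gammaEvenVar (n := n)) :
        MvPolynomial (EvenVar n) ℝ →ₗ[ℝ] JetPoly n)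
      (Algebra.TensorProduct.includeRight :
        OddPoly n →ₐ[ℝ] JetPoly n).toLinearMap

/-- The differential `γ` on local functions; `par p` is the derivation `∂/∂h_{μν}`, `p = {μ, ν}`,
of the coefficient algebra: `γ (f b) = ∑_{μ ≤ ν} (∂f/∂h_{μν}) (γ h_{μν}) b + f (γ b)`. -/
def gamma (n : ℕ) {R : Type} [CommRing R] [Algebra ℝ R]
    (par : Sym2 (Fin n) → Derivation ℝ R R) :
    LocalFunction n R →ₗ[ℝ] LocalFunction n R :=
  (∑ p : Sym2 (Fin n),
    TensorProduct.map (par p : R →ₗ[ℝ] R)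
      (LinearMap.mulLeft ℝ (1 ⊗ₜ gammaHSym p 0 : JetPoly n)))
  + TensorProduct.map LinearMap.id (gammaJet n)

/-- The cohomology `H(γ) = Ker γ / Im γ`. -/
abbrev Cohomology {A : Type} [AddCommGroup A] [Module ℝ A] (γ : A →ₗ[ℝ] A) : Type :=
  LinearMap.ker γ ⧸ (LinearMap.range γ).submoduleOf (LinearMap.ker γ)

/-! ### The fields as local functions, and the linearized curvatures -/

section Fields

variable {n : ℕ} {R : Type} [CommRing R] [Algebra ℝ R]

/-- A Grassmann polynomial as a local function. -/
def ofOdd (R : Type) [CommRing R] [Algebra ℝ R] (w : OddPoly n) : LocalFunction n R :=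
  1 ⊗ₜ (1 ⊗ₜ w)

/-- A commuting jet variable as a local function. -/
def ofEven (R : Type) [CommRing R] [Algebra ℝ R] (v : EvenVar n) : LocalFunction n R :=
  1 ⊗ₜ (MvPolynomial.X v ⊗ₜ 1)

/-- The jet of `h_{μν}`; `coord p` is the coordinate `h_{μν}`, `p = {μ, ν}`, in the coefficient
algebra. -/
def fieldH (coord : Sym2 (Fin n) → R) (μ ν : Fin n) : Jet n (LocalFunction n R) := fun J =>
  if hJ : J = 0 then coord s(μ, ν) ⊗ₜ 1 else ofEven R (.h J hJ s(μ, ν))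

/-- The linearized Riemann tensor `𝓡_{αβμν}`. -/
def riemann (coord : Sym2 (Fin n) → R) (α β μ ν : Fin n) : Jet n (LocalFunction n R) :=
  (-(1 / 2) : ℝ) •
    (pd α (pd μ (fieldH coord β ν)) + pd β (pd ν (fieldH coord α μ))
      - pd α (pd ν (fieldH coord β μ)) - pd β (pd μ (fieldH coord α ν)))

/-- The linearized Ricci tensor `𝓡_{μν} = η^{αλ} 𝓡_{λμαν}`. -/
def ricci (coord : Sym2 (Fin n) → R) (μ ν : Fin n) : Jet n (LocalFunction n R) :=
  ∑ α, ∑ l, eta α l • riemann coord l μ α ν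

/-- The linearized scalar curvature `𝓡 = η^{μν} 𝓡_{μν}`. -/
def scalar (coord : Sym2 (Fin n) → R) : Jet n (LocalFunction n R) :=
  ∑ μ, ∑ ν, eta μ ν • ricci coord μ ν

/-- The linearized Weyl tensor `𝓦_{αβγδ}` (antisymmetrizations have weight one). -/
def weyl (coord : Sym2 (Fin n) → R) (α β γ δ : Fin n) : Jet n (LocalFunction n R) :=
  riemann coord α β γ δ
    - (1 / ((n : ℝ) - 2)) •
      ((eta α γ • ricci coord δ β - eta α δ • ricci coord γ β)
        - (eta β γ • ricci coord δ α - eta β δ • ricci coord γ α))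
    + ((1 / (((n : ℝ) - 2) * ((n : ℝ) - 1))) * (eta α γ * eta δ β - eta α δ * eta γ β)) •
      scalar coord

/-- The linearized Schouten tensor `𝓚_{μν}`. -/
def schouten (coord : Sym2 (Fin n) → R) (μ ν : Fin n) : Jet n (LocalFunction n R) :=
  (1 / ((n : ℝ) - 2)) •
    (ricci coord μ ν - (1 / (2 * ((n : ℝ) - 1)) * eta μ ν) • scalar coord)

/-- The linearized Cotton tensor `𝓒_{αβμ} = ∂_μ 𝓚_{βα} - ∂_β 𝓚_{μα}`. -/
def cotton (coord : Sym2 (Fin n) → R) (α β μ : Fin n) : Jet n (LocalFunction n R) :=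
  pd μ (schouten coord β α) - pd β (schouten coord μ α)

/-- All antifields `h^{*μν}`, `C^{*μ}`, `ξ^*` and all their derivatives. -/
def antifields (n : ℕ) (R : Type) [CommRing R] [Algebra ℝ R] : Set (LocalFunction n R) :=
  {x | ∃ μ ν J, x = ofOdd R (oddHstar μ ν J)}
  ∪ {x | ∃ μ J, x = ofEven R (.Cstar J μ)}
  ∪ {x | ∃ J, x = ofEven R (.xistar J)}

/-- The ghosts `C_μ`, `∂_{[μ} C_{ν]}`, `ξ` and `∂_μ ξ`. -/
def ghosts (n : ℕ) (R : Type) [CommRing R] [Algebra ℝ R] : Set (LocalFunction n R) :=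
  {x | ∃ μ, x = ofOdd R (oddC μ 0)}
  ∪ {x | ∃ μ ν, x = ofOdd R (((1 / 2 : ℝ) • (pd μ (oddC ν) - pd ν (oddC μ))) 0)}
  ∪ {x | x = ofOdd R (oddXi 0)}
  ∪ {x | ∃ μ, x = ofOdd R (pd μ oddXi 0)}

/-- The functions `f([𝓦], [Φ^*], ξ, ∂_μ ξ, C_μ, ∂_{[μ} C_{ν]})`. -/
def weylFunctions (coord : Sym2 (Fin n) → R) : Subalgebra ℝ (LocalFunction n R) :=
  Algebra.adjoin ℝ
    ({x | ∃ α β γ δ J, x = weyl coord α β γ δ J} ∪ antifields n R ∪ ghosts n R)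

/-- The functions `f([𝓒], [Φ^*], ξ, ∂_μ ξ, C_μ, ∂_{[μ} C_{ν]})`. -/
def cottonFunctions (coord : Sym2 (Fin n) → R) : Subalgebra ℝ (LocalFunction n R) :=
  Algebra.adjoin ℝ
    ({x | ∃ α β μ J, x = cotton coord α β μ J} ∪ antifields n R ∪ ghosts n R)

end Fields

/-- `γ` squares to zero, every element of `S` is a cocycle, and sending an element of `S` to its
class is a linear isomorphism from `S` onto `H(γ)`. -/
def CohomologyIsomorphicTo {n : ℕ} {R : Type} [CommRing R] [Algebra ℝ R]
    (γ : LocalFunction n R →ₗ[ℝ] LocalFunction n R)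
    (S : Subalgebra ℝ (LocalFunction n R)) : Prop :=
  γ ∘ₗ γ = 0 ∧
  ∃ hS : ∀ s ∈ S, s ∈ LinearMap.ker γ,
    ∃ e : S ≃ₗ[ℝ] Cohomology γ,
      ∀ s : S, e s = Submodule.Quotient.mk ⟨s, hS s s.2⟩

end LinWeyl

end

/-!
The differential `γ` acts on the variables by a linear map from the jets of `h_{μν}` to the jets of
the ghosts, and is a Koszul type differential on the local functions. The proof inverts this linear
map as far as possible and then contracts the complex along the inverse.

*Variables.* Let `K` map `∂_J ξ`, for `J` of order at least `2`, to minus a derivative of the Schouten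
tensor, `∂_J C_ρ`, for `J` of order at least `2`, to a derivative of a Christoffel symbol corrected by
Schouten terms, `∂_μ C_ν` to `h_{μν} / 2`, and everything else to `0` (`primXi`, `primC`,
`contraction`). For `|J| ≥ 2` this involves a choice of two indices of the multiset `J`. Two choices
differ by Cotton tensors for `ξ`, and by Weyl and Cotton tensors for `C_ρ`, so that `K` is canonical
modulo the span of the derivatives of these tensors. Consequently `K γ` is the identity on the jets
of `h_{μν}` modulo this span, exactly so on the undifferentiated `h_{μν}`, while `γ K` is the identity
on the ghosts modulo `C_μ`, `∂_{[μ} C_{ν]}`, `ξ`, `∂_μ ξ` (`isPartialInverse_contraction`). For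
`n ≥ 4` the Cotton tensor is the divergence of the Weyl tensor up to the factor `n - 3` (`conf_div`);
for `n = 3` the Weyl tensor vanishes (`conf_three`). So one of the two tensors suffices in each case.

*Functions.* Extend `K` to an antiderivation `κ`. The Laplacian `N = γκ + κγ` is a derivation. It is
the sum of the Euler operator `E` on the functions of the undifferentiated `h_{μν}` and of a
derivation `M` commuting with `E` which, on the span of the other generators, is the projection
along the generators of `S`. Hence the local functions are the direct sum of the span of the
products `f s`, for `f` a function of the undifferentiated `h_{μν}` and `s ∈ S`, and of the
eigenspaces of `M` with eigenvalues `k ≥ 1` (`iSup_gradingPiece`). On the latter `N = E + k` is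
invertible, and on the former `N = E` has kernel `S`, and image the functions which vanish at
`h = 0`. Therefore the local functions are `S ⊕ Im N` with `S = Ker N`; since `γ` and `κ` vanish on
`S`, this gives the cohomology (`cohomologyIsomorphicTo_of_laplacian`).

*Coefficients.* What is needed of the functions of the undifferentiated `h_{μν}` is collected in
`IsContractibleCoeff`. For polynomials it is Euler's identity. For smooth functions the inverse of
`E + k` is `f ↦ ∫₀¹ t^(k-1) f(t h) dt`, and the case `k = 0` is reduced to `k = 1` by Hadamard's lemma.
-/

open scoped TensorProduct ContDiff
noncomputable section
namespace LinWeyl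

-- The ring structure of the nested tensor products is out of reach of the default depth.
set_option maxSynthPendingDepth 3

/-! ### Generators of the algebra of local functions -/

section Generators

variable {n : ℕ} {R : Type} [CommRing R] [Algebra ℝ R]

/-- A function of the undifferentiated `h_{μν}` as a local function. -/
def ofCoeff (n : ℕ) (r : R) : LocalFunction n R := r ⊗ₜ 1

/-- The linear combinations of anticommuting variables, as local functions. -/
def ofGrass (R : Type) [CommRing R] [Algebra ℝ R] :
    (OddVar n →₀ ℝ) →ₗ[ℝ] LocalFunction n R :=
  (Algebra.TensorProduct.includeRight.comp Algebra.TensorProduct.includeRight :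
    OddPoly n →ₐ[ℝ] LocalFunction n R).toLinearMap ∘ₗ ExteriorAlgebra.ι ℝ

theorem ofGrass_eq (m : OddVar n →₀ ℝ) :
    ofGrass R m = (1 : R) ⊗ₜ[ℝ] ((1 : MvPolynomial (EvenVar n) ℝ) ⊗ₜ[ℝ] ExteriorAlgebra.ι ℝ m) :=
  rfl

theorem ofCoeff_mul (r s : R) : ofCoeff n (r * s) = ofCoeff n r * ofCoeff n s := by
  simp [ofCoeff]

/-- The combination of anticommuting variables whose image in the Grassmann algebra is
`∂_J (γ h_p)`. -/
def gammaVec (p : Sym2 (Fin n)) (J : Multiset (Fin n)) : OddVar n →₀ ℝ :=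
  Sym2.lift ⟨fun μ ν => Finsupp.single (.C (μ ::ₘ J) ν) 1 + Finsupp.single (.C (ν ::ₘ J) μ) 1
      + (2 * eta μ ν) • Finsupp.single (.xi J) 1, fun μ ν => by
    dsimp only
    rw [eta_comm μ ν, add_comm (Finsupp.single (OddVar.C (μ ::ₘ J) ν) (1 : ℝ))]⟩ p

theorem gammaHSym_eq (p : Sym2 (Fin n)) (J : Multiset (Fin n)) :
    gammaHSym p J = ExteriorAlgebra.ι ℝ (gammaVec p J) := by
  induction p with | _ μ ν
  simp only [gammaHSym, gammaVec, Sym2.lift_mk, map_add, map_smul]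
  rfl

theorem ofGrass_mul_self (m : OddVar n →₀ ℝ) : ofGrass R m * ofGrass R m = 0 := by
  simp [ofGrass_eq]

theorem ofGrass_anticomm (m m' : OddVar n →₀ ℝ) :
    ofGrass R m * ofGrass R m' = -(ofGrass R m' * ofGrass R m) := by
  have h := ofGrass_mul_self (R := R) (m + m')
  simp only [map_add, mul_add, add_mul, ofGrass_mul_self, zero_add, add_zero] at h
  exact eq_neg_of_add_eq_zero_right h

/-- The generators of the algebra of local functions. -/
def generators (n : ℕ) (R : Type) [CommRing R] [Algebra ℝ R] : Set (LocalFunction n R) :=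
  Set.range (ofCoeff n) ∪ Set.range (ofEven R) ∪ Set.range (ofGrass R)

theorem adjoin_generators : Algebra.adjoin ℝ (generators n R) = ⊤ := by
  set A := Algebra.adjoin ℝ (generators n R) with hA
  have hC : ∀ r : R, ofCoeff n r ∈ A := fun r => Algebra.subset_adjoin (.inl (.inl ⟨r, rfl⟩))
  have hE : ∀ P : MvPolynomial (EvenVar n) ℝ, (1 : R) ⊗ₜ[ℝ] (P ⊗ₜ[ℝ] (1 : OddPoly n)) ∈ A := by
    intro P
    induction P using MvPolynomial.induction_on with
    | C r =>
      rw [← MvPolynomial.algebraMap_eq, Algebra.algebraMap_eq_smul_one, TensorProduct.smul_tmul,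
        TensorProduct.tmul_smul, TensorProduct.tmul_smul]
      exact A.smul_mem A.one_mem r
    | add a b ha hb => simpa [TensorProduct.tmul_add, TensorProduct.add_tmul] using A.add_mem ha hb
    | mul_X a v ha =>
      simpa [ofEven] using A.mul_mem ha (Algebra.subset_adjoin (.inl (.inr ⟨v, rfl⟩)))
  have hO : ∀ w : OddPoly n, (1 : R) ⊗ₜ[ℝ] ((1 : MvPolynomial (EvenVar n) ℝ) ⊗ₜ[ℝ] w) ∈ A := by
    intro w
    induction w using ExteriorAlgebra.induction with
    | algebraMap r =>
      rw [Algebra.algebraMap_eq_smul_one, TensorProduct.tmul_smul, TensorProduct.tmul_smul]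
      exact A.smul_mem A.one_mem r
    | ι m => exact Algebra.subset_adjoin (.inr ⟨m, rfl⟩)
    | mul a b ha hb => simpa using A.mul_mem ha hb
    | add a b ha hb => simpa [TensorProduct.tmul_add] using A.add_mem ha hb
  rw [eq_top_iff]
  rintro x -
  induction x using TensorProduct.induction_on with
  | zero => exact A.zero_mem
  | add x y hx hy => exact A.add_mem hx hy
  | tmul r j =>
    induction j using TensorProduct.induction_on with
    | zero => rw [TensorProduct.tmul_zero]; exact A.zero_mem
    | add x y hx hy => rw [TensorProduct.tmul_add]; exact A.add_mem hx hy
    | tmul P w => simpa [ofCoeff] using A.mul_mem (A.mul_mem (hC r) (hE P)) (hO w)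

/-- A linear map of local functions which is `0` at `1` and satisfies the Leibniz rule for products
with a generator on the left satisfies it for all products. -/
theorem leibniz_of_generators (N : LocalFunction n R →ₗ[ℝ] LocalFunction n R) (h1 : N 1 = 0)
    (hN : ∀ g ∈ generators n R, ∀ x, N (g * x) = N g * x + g * N x) (x y : LocalFunction n R) :
    N (x * y) = N x * y + x * N y := by
  have hx : x ∈ Algebra.adjoin ℝ (generators n R) := by rw [adjoin_generators]; trivial
  induction hx using Algebra.adjoin_induction generalizing y with
  | mem g hg => exact hN g hg y
  | algebraMap r =>
    rw [Algebra.algebraMap_eq_smul_one]; simp [h1]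
  | add a b _ _ ha hb => rw [add_mul, map_add, ha, hb, map_add, add_mul, add_mul]; abel
  | mul a b _ _ ha hb =>
    rw [mul_assoc, ha, hb, ha b]; simp only [mul_add, add_mul, mul_assoc, add_assoc]

/-- A derivation of the algebra of local functions is determined on the generators. -/
theorem eq_zero_of_generators (N : LocalFunction n R →ₗ[ℝ] LocalFunction n R)
    (hN : ∀ x y, N (x * y) = N x * y + x * N y) (h0 : ∀ g ∈ generators n R, N g = 0) : N = 0 := by
  have h1 : N 1 = 0 := by simpa using hN 1 1
  refine LinearMap.ext fun x => ?_
  have hx : x ∈ Algebra.adjoin ℝ (generators n R) := by rw [adjoin_generators]; trivial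
  induction hx using Algebra.adjoin_induction with
  | mem g hg => exact h0 g hg
  | algebraMap r => rw [Algebra.algebraMap_eq_smul_one]; simp [h1]
  | add a b _ _ ha hb => rw [map_add, ha, hb]; simp
  | mul a b _ _ ha hb => rw [hN, ha, hb]; simp

theorem ofCoeff_commute (r : R) (x : LocalFunction n R) : ofCoeff n r * x = x * ofCoeff n r := by
  induction x using TensorProduct.induction_on with
  | zero => simp
  | add x y hx hy => rw [mul_add, add_mul, hx, hy]
  | tmul s j => simp [ofCoeff, mul_comm]

theorem ofEven_commute (v : EvenVar n) (x : LocalFunction n R) :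
    ofEven R v * x = x * ofEven R v := by
  induction x using TensorProduct.induction_on with
  | zero => simp
  | add x y hx hy => rw [mul_add, add_mul, hx, hy]
  | tmul s j =>
    have : (MvPolynomial.X v ⊗ₜ 1 : JetPoly n) * j = j * (MvPolynomial.X v ⊗ₜ 1) := by
      induction j using TensorProduct.induction_on with
      | zero => simp
      | add x y hx hy => rw [mul_add, add_mul, hx, hy]
      | tmul P w => simp [mul_comm]
    simp [ofEven, this]

end Generators

/-! ### The differential on products with generators -/

section Gamma

variable {n : ℕ} {R : Type} [CommRing R] [Algebra ℝ R]

theorem gammaJet_tmul (P : MvPolynomial (EvenVar n) ℝ) (w : OddPoly n) :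
    gammaJet n (P ⊗ₜ w) = MvPolynomial.mkDerivation ℝ (gammaEvenVar (n := n)) P * (1 ⊗ₜ w) := rfl

theorem gamma_tmul (par : Sym2 (Fin n) → Derivation ℝ R R) (r : R) (j : JetPoly n) :
    gamma n par (r ⊗ₜ j) =
      ∑ p, par p r ⊗ₜ[ℝ] ((1 ⊗ₜ gammaHSym p 0 : JetPoly n) * j) + r ⊗ₜ gammaJet n j := by
  simp [gamma, LinearMap.sum_apply]

theorem smul_jetPoly (P : MvPolynomial (EvenVar n) ℝ) (j : JetPoly n) :
    P • j = (P ⊗ₜ 1 : JetPoly n) * j := by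
  rw [Algebra.smul_def]; rfl

theorem tmul_one_commute (P : MvPolynomial (EvenVar n) ℝ) (j : JetPoly n) :
    (P ⊗ₜ 1 : JetPoly n) * j = j * (P ⊗ₜ 1) := by
  induction j using TensorProduct.induction_on with
  | zero => simp
  | add x y hx hy => rw [mul_add, add_mul, hx, hy]
  | tmul P w => simp [mul_comm]

theorem gammaJet_X_mul (v : EvenVar n) (j : JetPoly n) :
    gammaJet n ((MvPolynomial.X v ⊗ₜ 1 : JetPoly n) * j) =
      gammaEvenVar v * j + (MvPolynomial.X v ⊗ₜ 1 : JetPoly n) * gammaJet n j := by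
  induction j using TensorProduct.induction_on with
  | zero => simp
  | add x y hx hy => rw [mul_add, map_add, hx, hy, map_add, mul_add, mul_add]; abel
  | tmul P w =>
    rw [Algebra.TensorProduct.tmul_mul_tmul, one_mul, gammaJet_tmul, gammaJet_tmul,
      Derivation.leibniz, MvPolynomial.mkDerivation_X, smul_jetPoly, smul_jetPoly, add_mul,
      tmul_one_commute P, mul_assoc, mul_assoc, Algebra.TensorProduct.tmul_mul_tmul]
    simp [add_comm]

theorem gammaEvenVar_anticomm (v : EvenVar n) (m : OddVar n →₀ ℝ) :
    gammaEvenVar v * (1 ⊗ₜ ExteriorAlgebra.ι ℝ m : JetPoly n) =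
      -((1 ⊗ₜ ExteriorAlgebra.ι ℝ m : JetPoly n) * gammaEvenVar v) := by
  cases v with
  | h J hJ p =>
    have h := ExteriorAlgebra.ι_add_mul_swap (R := ℝ) (gammaVec p J) m
    rw [gammaEvenVar, gammaHSym_eq, Algebra.TensorProduct.tmul_mul_tmul,
      Algebra.TensorProduct.tmul_mul_tmul, eq_neg_of_add_eq_zero_left h, TensorProduct.tmul_neg]
  | Cstar J μ => simp [gammaEvenVar]
  | xistar J => simp [gammaEvenVar]

/-- `γ` is odd: it anticommutes with multiplication by an anticommuting variable. -/
theorem gammaJet_ι_mul (m : OddVar n →₀ ℝ) (j : JetPoly n) :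
    gammaJet n ((1 ⊗ₜ ExteriorAlgebra.ι ℝ m : JetPoly n) * j) =
      -((1 ⊗ₜ ExteriorAlgebra.ι ℝ m : JetPoly n) * gammaJet n j) := by
  have key : ∀ P : MvPolynomial (EvenVar n) ℝ,
      MvPolynomial.mkDerivation ℝ (gammaEvenVar (n := n)) P * (1 ⊗ₜ ExteriorAlgebra.ι ℝ m) =
      -((1 ⊗ₜ ExteriorAlgebra.ι ℝ m : JetPoly n) *
        MvPolynomial.mkDerivation ℝ (gammaEvenVar (n := n)) P) := by
    intro P
    induction P using MvPolynomial.induction_on with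
    | C r => simp
    | add a b ha hb => rw [map_add, add_mul, mul_add, ha, hb, neg_add]
    | mul_X a v ha =>
      rw [Derivation.leibniz, MvPolynomial.mkDerivation_X, smul_jetPoly, smul_jetPoly, add_mul,
        mul_assoc, mul_assoc, ha, gammaEvenVar_anticomm, mul_add, ← mul_assoc _ (a ⊗ₜ[ℝ] _),
        ← tmul_one_commute a, ← mul_assoc _ (MvPolynomial.X v ⊗ₜ[ℝ] _),
        ← tmul_one_commute (MvPolynomial.X v)]
      simp only [mul_neg, mul_assoc, neg_add]
  induction j using TensorProduct.induction_on with
  | zero => simp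
  | add x y hx hy => rw [mul_add, map_add, hx, hy, map_add, mul_add, neg_add]
  | tmul P w =>
    rw [Algebra.TensorProduct.tmul_mul_tmul, one_mul, gammaJet_tmul, gammaJet_tmul, ← mul_assoc,
      ← neg_mul, ← key, mul_assoc, Algebra.TensorProduct.tmul_mul_tmul, one_mul]

variable (par : Sym2 (Fin n) → Derivation ℝ R R)

theorem gammaJet_one : gammaJet n 1 = 0 := by
  rw [Algebra.TensorProduct.one_def, gammaJet_tmul]; simp

theorem gamma_ofCoeff (r : R) :
    gamma n par (ofCoeff n r) = ∑ p, ofCoeff n (par p r) * ofGrass R (gammaVec p 0) := by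
  simp [ofCoeff, gamma_tmul, gammaJet_one, ofGrass_eq, gammaHSym_eq]

theorem gamma_ofEven (v : EvenVar n) : gamma n par (ofEven R v) = 1 ⊗ₜ gammaEvenVar v := by
  simp [ofEven, gamma_tmul, gammaJet_tmul, ← Algebra.TensorProduct.one_def]

theorem gamma_ofGrass (m : OddVar n →₀ ℝ) : gamma n par (ofGrass R m) = 0 := by
  simp [ofGrass_eq, gamma_tmul, gammaJet_tmul]

theorem gamma_ofCoeff_mul (r : R) (x : LocalFunction n R) :
    gamma n par (ofCoeff n r * x) =
      gamma n par (ofCoeff n r) * x + ofCoeff n r * gamma n par x := by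
  induction x using TensorProduct.induction_on with
  | zero => simp
  | add x y hx hy => rw [mul_add, map_add, hx, hy, map_add, mul_add, mul_add]; abel
  | tmul s j =>
    rw [gamma_ofCoeff, gamma_tmul]
    simp [ofCoeff, gamma_tmul, ofGrass_eq, gammaHSym_eq, mul_add, Finset.mul_sum, Finset.sum_mul,
      TensorProduct.add_tmul, Finset.sum_add_distrib, mul_comm]
    abel

theorem gamma_ofEven_mul (v : EvenVar n) (x : LocalFunction n R) :
    gamma n par (ofEven R v * x) =
      gamma n par (ofEven R v) * x + ofEven R v * gamma n par x := by
  induction x using TensorProduct.induction_on with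
  | zero => simp
  | add x y hx hy => rw [mul_add, map_add, hx, hy, map_add, mul_add, mul_add]; abel
  | tmul s j =>
    rw [gamma_ofEven, gamma_tmul, ofEven, Algebra.TensorProduct.tmul_mul_tmul, gamma_tmul,
      gammaJet_X_mul, mul_add, Finset.mul_sum]
    simp only [one_mul, Algebra.TensorProduct.tmul_mul_tmul, TensorProduct.tmul_add,
      ← mul_assoc, ← tmul_one_commute (MvPolynomial.X v)]
    abel

theorem gamma_ofGrass_mul (m : OddVar n →₀ ℝ) (x : LocalFunction n R) :
    gamma n par (ofGrass R m * x) = -(ofGrass R m * gamma n par x) := by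
  induction x using TensorProduct.induction_on with
  | zero => simp
  | add x y hx hy => rw [mul_add, map_add, hx, hy, map_add, mul_add, neg_add]
  | tmul s j =>
    have h : ∀ p, (1 ⊗ₜ gammaHSym p 0 : JetPoly n) * ((1 ⊗ₜ ExteriorAlgebra.ι ℝ m) * j) =
        -((1 ⊗ₜ ExteriorAlgebra.ι ℝ m : JetPoly n) * ((1 ⊗ₜ gammaHSym p 0) * j)) := fun p => by
      have h := ExteriorAlgebra.ι_add_mul_swap (R := ℝ) (gammaVec p 0) m
      rw [← mul_assoc, ← mul_assoc, gammaHSym_eq, Algebra.TensorProduct.tmul_mul_tmul,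
        Algebra.TensorProduct.tmul_mul_tmul, eq_neg_of_add_eq_zero_left h, TensorProduct.tmul_neg,
        neg_mul]
    rw [ofGrass_eq, gamma_tmul, Algebra.TensorProduct.tmul_mul_tmul, gamma_tmul, mul_add,
      Finset.mul_sum, gammaJet_ι_mul]
    simp only [one_mul, Algebra.TensorProduct.tmul_mul_tmul, h, TensorProduct.tmul_neg,
      Finset.sum_neg_distrib, neg_add]

end Gamma

/-! ### The antiderivation extending a linear map of the anticommuting variables -/

section Kappa

variable {n : ℕ} {R : Type} [CommRing R] [Algebra ℝ R]

/-- The antiderivation, with values in the local functions, of the Grassmann algebra which extends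
`K`; the values of `K` are required to be central. -/
def kappaOdd (K : (OddVar n →₀ ℝ) →ₗ[ℝ] LocalFunction n R)
    (hK : ∀ m x, K m * x = x * K m) : OddPoly n →ₗ[ℝ] LocalFunction n R :=
  CliffordAlgebra.foldr' (0 : QuadraticForm ℝ (OddVar n →₀ ℝ))
    (((LinearMap.mul ℝ (LocalFunction n R)) ∘ₗ K).compl₂
      ((Algebra.TensorProduct.includeRight.comp Algebra.TensorProduct.includeRight :
        OddPoly n →ₐ[ℝ] LocalFunction n R).toLinearMap ∘ₗ LinearMap.fst ℝ _ _)
    - ((LinearMap.mul ℝ (LocalFunction n R)) ∘ₗ ofGrass R).compl₂ (LinearMap.snd ℝ _ _))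
    (fun m w y => by
      -- Applying the recursion twice with the same `m` gives `0`: `K m` is central and `m² = 0`.
      have h := ofGrass_mul_self (R := R) m
      simp only [LinearMap.sub_apply, LinearMap.compl₂_apply, LinearMap.comp_apply,
        LinearMap.fst_apply, LinearMap.snd_apply, LinearMap.mul_apply', AlgHom.toLinearMap_apply,
        map_mul, zero_apply, zero_smul]
      change K m * (ofGrass R m * _) - _ = _
      rw [mul_sub, ← mul_assoc, ← mul_assoc, hK, ← mul_assoc, h, zero_mul, sub_zero, sub_self]) 0

/-- The antiderivation `κ` of local functions which extends `K` on the anticommuting variables and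
annihilates the commuting ones. -/
def kappa (K : (OddVar n →₀ ℝ) →ₗ[ℝ] LocalFunction n R)
    (hK : ∀ m x, K m * x = x * K m) : LocalFunction n R →ₗ[ℝ] LocalFunction n R :=
  TensorProduct.lift <| (LinearMap.mul ℝ (LocalFunction n R) ∘ₗ
      (Algebra.TensorProduct.includeLeft : R →ₐ[ℝ] LocalFunction n R).toLinearMap).compl₂ <|
    TensorProduct.lift <| (LinearMap.mul ℝ (LocalFunction n R) ∘ₗ
      (Algebra.TensorProduct.includeRight.comp Algebra.TensorProduct.includeLeft :
        MvPolynomial (EvenVar n) ℝ →ₐ[ℝ] LocalFunction n R).toLinearMap).compl₂ (kappaOdd K hK)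

variable (K : (OddVar n →₀ ℝ) →ₗ[ℝ] LocalFunction n R) (hK : ∀ m x, K m * x = x * K m)

theorem kappaOdd_one : kappaOdd K hK 1 = 0 := by
  rw [← map_one (algebraMap ℝ (OddPoly n))]
  exact (CliffordAlgebra.foldr'_algebraMap _ _ _ _ 1).trans (by simp)

theorem kappaOdd_ι_mul (m : OddVar n →₀ ℝ) (w : OddPoly n) :
    kappaOdd K hK (ExteriorAlgebra.ι ℝ m * w) =
      K m * ofOdd R w - ofGrass R m * kappaOdd K hK w :=
  CliffordAlgebra.foldr'_ι_mul ..

theorem kappa_tmul (r : R) (P : MvPolynomial (EvenVar n) ℝ) (w : OddPoly n) :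
    kappa K hK (r ⊗ₜ (P ⊗ₜ w)) = (r ⊗ₜ 1) * ((1 ⊗ₜ (P ⊗ₜ 1)) * kappaOdd K hK w) := rfl

theorem kappa_one : kappa K hK 1 = 0 := by
  rw [Algebra.TensorProduct.one_def, Algebra.TensorProduct.one_def, kappa_tmul, kappaOdd_one]
  simp

theorem kappa_ofCoeff_mul (r : R) (x : LocalFunction n R) :
    kappa K hK (ofCoeff n r * x) = ofCoeff n r * kappa K hK x := by
  induction x using TensorProduct.induction_on with
  | zero => simp
  | add x y hx hy => rw [mul_add, map_add, hx, hy, map_add, mul_add]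
  | tmul s j =>
    induction j using TensorProduct.induction_on with
    | zero => simp
    | add x y hx hy => rw [TensorProduct.tmul_add, mul_add, map_add, hx, hy, map_add, mul_add]
    | tmul P w =>
      rw [ofCoeff, Algebra.TensorProduct.tmul_mul_tmul, one_mul, kappa_tmul, kappa_tmul,
        ← mul_assoc (r ⊗ₜ[ℝ] (1 : JetPoly n)), Algebra.TensorProduct.tmul_mul_tmul, one_mul]

theorem kappa_ofEven_mul (v : EvenVar n) (x : LocalFunction n R) :
    kappa K hK (ofEven R v * x) = ofEven R v * kappa K hK x := by
  induction x using TensorProduct.induction_on with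
  | zero => simp
  | add x y hx hy => rw [mul_add, map_add, hx, hy, map_add, mul_add]
  | tmul s j =>
    induction j using TensorProduct.induction_on with
    | zero => simp
    | add x y hx hy => rw [TensorProduct.tmul_add, mul_add, map_add, hx, hy, map_add, mul_add]
    | tmul P w =>
      have h := ofCoeff_commute s (ofEven R v)
      rw [ofCoeff] at h
      rw [kappa_tmul, ← mul_assoc, ← h, mul_assoc, ← mul_assoc (ofEven R v), ofEven,
        Algebra.TensorProduct.tmul_mul_tmul, Algebra.TensorProduct.tmul_mul_tmul,
        Algebra.TensorProduct.tmul_mul_tmul, Algebra.TensorProduct.tmul_mul_tmul, one_mul, one_mul,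
        one_mul, one_mul, kappa_tmul]

theorem kappa_ofGrass_mul (m : OddVar n →₀ ℝ) (x : LocalFunction n R) :
    kappa K hK (ofGrass R m * x) = K m * x - ofGrass R m * kappa K hK x := by
  induction x using TensorProduct.induction_on with
  | zero => simp
  | add x y hx hy => rw [mul_add, map_add, hx, hy, map_add, mul_add, mul_add]; abel
  | tmul s j =>
    induction j using TensorProduct.induction_on with
    | zero => simp
    | add x y hx hy =>
      rw [TensorProduct.tmul_add, mul_add, map_add, hx, hy, map_add, mul_add, mul_add]; abel
    | tmul P w =>
      have h := ofCoeff_commute (n := n) s (ofGrass R m)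
      have h' : (1 : R) ⊗ₜ[ℝ] (P ⊗ₜ[ℝ] (1 : OddPoly n)) * ofGrass R m =
          ofGrass R m * (1 : R) ⊗ₜ[ℝ] (P ⊗ₜ[ℝ] (1 : OddPoly n)) := by simp [ofGrass_eq]
      have hs : (s ⊗ₜ[ℝ] (P ⊗ₜ[ℝ] w) : LocalFunction n R) =
          ofCoeff n s * (1 ⊗ₜ (P ⊗ₜ 1) * ofOdd R w) := by simp [ofCoeff, ofOdd]
      have h1 : ofGrass R m * s ⊗ₜ[ℝ] (P ⊗ₜ[ℝ] w) = s ⊗ₜ (P ⊗ₜ (ExteriorAlgebra.ι ℝ m * w)) := by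
        simp [ofGrass_eq]
      rw [h1, kappa_tmul, kappaOdd_ι_mul, kappa_tmul, hs]
      change ofCoeff n s * _ = _ - _ * (ofCoeff n s * _)
      rw [← mul_assoc (ofGrass R m), ← h, mul_assoc, ← mul_assoc (ofGrass R m), ← h', hK m, hK m]
      simp only [mul_sub, mul_assoc]

end Kappa

/-! ### Contractible coefficients and partial inverses of the differential -/

section Laplacian

variable {n : ℕ} {R : Type} [CommRing R] [Algebra ℝ R]

/-- The Euler derivation `∑ h_p ∂/∂h_p` of the coefficient algebra. -/
def euler (coord : Sym2 (Fin n) → R) (par : Sym2 (Fin n) → Derivation ℝ R R) : Derivation ℝ R R :=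
  ∑ p, coord p • par p

theorem euler_apply (coord : Sym2 (Fin n) → R) (par : Sym2 (Fin n) → Derivation ℝ R R) (r : R) :
    euler coord par r = ∑ p, coord p * par p r := by
  rw [euler, ← Derivation.coeFnAddMonoidHom_apply, map_sum, Finset.sum_apply]
  rfl

/-- The properties of the functions of the undifferentiated `h_{μν}` which make the coefficients
contractible: `ev` is the evaluation at the origin, and the Euler operator `E` has kernel `ℝ`, has
all functions vanishing at the origin in its image, and `E + k` is invertible for `k ≥ 1`. -/
structure IsContractibleCoeff (coord : Sym2 (Fin n) → R) (par : Sym2 (Fin n) → Derivation ℝ R R)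
    (ev : R →ₐ[ℝ] ℝ) : Prop where
  par_comm : ∀ p q r, par p (par q r) = par q (par p r)
  par_coord : ∀ p q, par p (coord q) = if p = q then 1 else 0
  ev_coord : ∀ p, ev (coord p) = 0
  euler_add_bijective : ∀ k : ℕ, 1 ≤ k →
    Function.Bijective fun r : R => euler coord par r + (k : ℝ) • r
  euler_ker : ∀ r, euler coord par r = 0 → r = algebraMap ℝ R (ev r)
  euler_range : ∀ r, ∃ s, euler coord par s = r - algebraMap ℝ R (ev r)

/-- The span of the proper derivatives of `h_{μν}`. -/
def properJets (n : ℕ) (R : Type) [CommRing R] [Algebra ℝ R] :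
    Submodule ℝ (LocalFunction n R) :=
  Submodule.span ℝ {x | ∃ J hJ p, x = ofEven R (.h J hJ p)}

/-- The span of all derivatives of `h_{μν}`, the undifferentiated ones included. -/
def jets (coord : Sym2 (Fin n) → R) : Submodule ℝ (LocalFunction n R) :=
  properJets n R ⊔ Submodule.span ℝ (Set.range fun p => ofCoeff n (coord p))

/-- The antifields `∂_J h^{*μν}` and the ghosts `C_μ`, `∂_{[μ} C_{ν]}`, `ξ`, `∂_μ ξ`, as vectors in
the span of the anticommuting variables. -/
def inertVecs (n : ℕ) : Set (OddVar n →₀ ℝ) :=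
  {m | ∃ μ ν J, m = Finsupp.single (.hstar J s(μ, ν)) 1}
  ∪ ({m | ∃ μ, m = Finsupp.single (.C 0 μ) 1}
  ∪ {m | ∃ μ ν, m = (1 / 2 : ℝ) •
      (Finsupp.single (.C (μ ::ₘ 0) ν) 1 - Finsupp.single (.C (ν ::ₘ 0) μ) 1)}
  ∪ {m | m = Finsupp.single (.xi 0) 1}
  ∪ {m | ∃ μ, m = Finsupp.single (.xi (μ ::ₘ 0)) 1})

/-- A linear map `K` from the anticommuting variables to the jets of `h_{μν}` which inverts `γ`
up to the span of `X` on the jets of `h_{μν}` (exactly, on the undifferentiated ones), and up to the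
ghosts of lowest order and the antifields on the anticommuting variables. -/
structure IsPartialInverse (coord : Sym2 (Fin n) → R) (par : Sym2 (Fin n) → Derivation ℝ R R)
    (X : Set (LocalFunction n R)) (K : (OddVar n →₀ ℝ) →ₗ[ℝ] LocalFunction n R) : Prop where
  X_subset : X ⊆ properJets n R
  gamma_X : ∀ x ∈ X, gamma n par x = 0
  K_mem : ∀ m, K m ∈ jets coord
  K_eq_zero : ∀ m ∈ inertVecs n, K m = 0
  gamma_K : ∀ m, gamma n par (K m) - ofGrass R m ∈ Submodule.span ℝ (antifields n R ∪ ghosts n R)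
  K_gamma_zero : ∀ p, K (gammaVec p 0) = ofCoeff n (coord p)
  K_gamma : ∀ J hJ p, K (gammaVec p J) - ofEven R (.h J hJ p) ∈ Submodule.span ℝ X

theorem jets_induction {coord : Sym2 (Fin n) → R} (p : LocalFunction n R → Prop)
    (zero : p 0) (add : ∀ x y, p x → p y → p (x + y)) (smul : ∀ (c : ℝ) x, p x → p (c • x))
    (coeff : ∀ q, p (ofCoeff n (coord q))) (even : ∀ J hJ q, p (ofEven R (.h J hJ q)))
    {x : LocalFunction n R} (hx : x ∈ jets coord) : p x := by
  rw [jets, properJets, ← Submodule.span_union] at hx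
  induction hx using Submodule.span_induction with
  | mem x h =>
    rcases h with ⟨J, hJ, q, rfl⟩ | ⟨q, rfl⟩
    · exact even J hJ q
    · exact coeff q
  | zero => exact zero
  | add x y _ _ hx hy => exact add x y hx hy
  | smul c x _ hx => exact smul c x hx

theorem jets_commute {coord : Sym2 (Fin n) → R} {a : LocalFunction n R} (ha : a ∈ jets coord)
    (x : LocalFunction n R) : a * x = x * a := by
  refine jets_induction (fun a => a * x = x * a) ?_ ?_ ?_ ?_ ?_ ha
  · simp
  · intro a b ha hb; rw [add_mul, mul_add, ha, hb]
  · intro c a ha; rw [smul_mul_assoc, ha, mul_smul_comm]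
  · intro q; exact ofCoeff_commute _ x
  · intro J hJ q; exact ofEven_commute _ x

theorem gamma_jets_mul {coord : Sym2 (Fin n) → R} (par : Sym2 (Fin n) → Derivation ℝ R R)
    {a : LocalFunction n R} (ha : a ∈ jets coord) (x : LocalFunction n R) :
    gamma n par (a * x) = gamma n par a * x + a * gamma n par x := by
  refine jets_induction (fun a => gamma n par (a * x) = gamma n par a * x + a * gamma n par x) ?_ ?_ ?_ ?_ ?_ ha
  · simp
  · intro a b ha hb; rw [add_mul, map_add, ha, hb, map_add, add_mul, add_mul]; abel
  · intro c a ha; simp only [smul_mul_assoc, map_smul, ha, smul_add]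
  · intro q; exact gamma_ofCoeff_mul par _ x
  · intro J hJ q; exact gamma_ofEven_mul par _ x

theorem kappa_jets_mul {coord : Sym2 (Fin n) → R} (K : (OddVar n →₀ ℝ) →ₗ[ℝ] LocalFunction n R)
    (hK : ∀ m x, K m * x = x * K m) {a : LocalFunction n R} (ha : a ∈ jets coord)
    (x : LocalFunction n R) : kappa K hK (a * x) = a * kappa K hK x := by
  refine jets_induction (fun a => kappa K hK (a * x) = a * kappa K hK x) ?_ ?_ ?_ ?_ ?_ ha
  · simp
  · intro a b ha hb; rw [add_mul, map_add, ha, hb, add_mul]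
  · intro c a ha; simp only [smul_mul_assoc, map_smul, ha]
  · intro q; exact kappa_ofCoeff_mul K hK _ x
  · intro J hJ q; exact kappa_ofEven_mul K hK _ x

/-- The combination of anticommuting variables which is the image under `γ` of a commuting jet
variable. -/
def evenVec : EvenVar n → OddVar n →₀ ℝ
  | .h J _ p => gammaVec p J
  | .Cstar _ _ => 0
  | .xistar _ => 0

theorem gamma_ofEven' (par : Sym2 (Fin n) → Derivation ℝ R R) (v : EvenVar n) :
    gamma n par (ofEven R v) = ofGrass R (evenVec v) := by
  rw [gamma_ofEven]
  cases v <;> simp [gammaEvenVar, evenVec, ofGrass_eq, gammaHSym_eq]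

/-- `γ² = 0`. -/
theorem gamma_gamma {par : Sym2 (Fin n) → Derivation ℝ R R}
    (hpar : ∀ p q r, par p (par q r) = par q (par p r)) :
    gamma n par ∘ₗ gamma n par = 0 := by
  have hC : ∀ r, gamma n par (gamma n par (ofCoeff n r)) = 0 := by
    intro r
    simp only [gamma_ofCoeff, map_sum, gamma_ofCoeff_mul, gamma_ofGrass, mul_zero, add_zero,
      Finset.sum_mul]
    have : ∀ S : LocalFunction n R, S = -S → S = 0 := fun S h => by
      have h2 : (2 : ℝ) • S = 0 := by rw [two_smul]; nth_rewrite 2 [h]; exact add_neg_cancel S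
      exact (smul_eq_zero.1 h2).resolve_left two_ne_zero
    apply this
    -- The second derivatives are symmetric in `p`, `q` and the ghosts antisymmetric.
    nth_rewrite 1 [Finset.sum_comm]
    rw [← Finset.sum_neg_distrib]
    refine Finset.sum_congr rfl fun p _ => ?_
    rw [← Finset.sum_neg_distrib]
    refine Finset.sum_congr rfl fun q _ => ?_
    rw [hpar, mul_assoc, mul_assoc, ofGrass_anticomm, mul_neg]
  have h1 : gamma n par 1 = 0 := by
    simpa [ofCoeff, ← Algebra.TensorProduct.one_def] using gamma_ofCoeff par (n := n) (1 : R)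
  refine eq_zero_of_generators _ (leibniz_of_generators _ (by simp [h1]) ?_) ?_
  · rintro _ ((⟨r, rfl⟩ | ⟨v, rfl⟩) | ⟨m, rfl⟩) x
    · simp only [LinearMap.comp_apply, hC]
      rw [gamma_ofCoeff_mul, map_add, gamma_ofCoeff_mul, gamma_ofCoeff]
      simp only [Finset.sum_mul, map_sum, mul_assoc, gamma_ofCoeff_mul, gamma_ofGrass_mul]
      have := hC r
      rw [gamma_ofCoeff] at this
      simp only [map_sum, gamma_ofCoeff_mul, gamma_ofGrass, mul_zero, add_zero] at this
      simp only [mul_neg, Finset.sum_add_distrib, Finset.sum_neg_distrib, ← mul_assoc,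
        ← Finset.sum_mul]
      rw [this]
      abel
    · simp only [LinearMap.comp_apply, gamma_ofEven_mul, map_add, gamma_ofEven',
        gamma_ofGrass_mul, gamma_ofGrass]
      simp
    · simp [gamma_ofGrass_mul, gamma_ofGrass]
  · rintro _ ((⟨r, rfl⟩ | ⟨v, rfl⟩) | ⟨m, rfl⟩)
    · exact hC r
    · simp [gamma_ofEven', gamma_ofGrass]
    · simp [gamma_ofGrass]

end Laplacian

/-! ### Homological algebra of the Laplacian -/

section Abstract

/-- If the Laplacian `γκ + κγ` splits the space as `S ⊕ image`, with `S` its kernel and both `γ` and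
`κ` vanishing on `S`, then `S` represents the cohomology of `γ`. -/
theorem cohomologyIsomorphicTo_of_laplacian {n : ℕ} {R : Type} [CommRing R] [Algebra ℝ R]
    {γ κ : LocalFunction n R →ₗ[ℝ] LocalFunction n R} {S : Subalgebra ℝ (LocalFunction n R)}
    (hγ : γ ∘ₗ γ = 0) (hS : ∀ s ∈ S, γ s = 0) (hκ : ∀ s ∈ S, κ s = 0)
    (hsplit : ∀ x, ∃ s ∈ S, ∃ y, x = s + (γ (κ y) + κ (γ y)))
    (hker : ∀ x, γ (κ x) + κ (γ x) = 0 → x ∈ S)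
    (hdisj : ∀ x, γ (κ x) + κ (γ x) ∈ S → γ (κ x) + κ (γ x) = 0) :
    CohomologyIsomorphicTo γ S := by
  have hγγ : ∀ x, γ (γ x) = 0 := fun x => LinearMap.congr_fun hγ x
  refine ⟨hγ, hS, ?_⟩
  let f : S →ₗ[ℝ] Cohomology γ := (Submodule.mkQ _) ∘ₗ
    LinearMap.codRestrict (LinearMap.ker γ) (Subalgebra.toSubmodule S).subtype (fun s => hS s s.2)
  have hf : ∀ s : S, f s = Submodule.Quotient.mk ⟨s, hS s s.2⟩ := fun s => rfl
  refine ⟨LinearEquiv.ofBijective f ⟨?_, ?_⟩, hf⟩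
  -- If `s = γ y` with `y = s' + N y'`, then `s = N (γ y')` lies in `S ∩ Im N = 0`.
  · rw [← LinearMap.ker_eq_bot, LinearMap.ker_eq_bot']
    intro s hs
    rw [hf, Submodule.Quotient.mk_eq_zero] at hs
    obtain ⟨y, hy⟩ := hs
    change γ y = s at hy
    obtain ⟨s', hs', y', rfl⟩ := hsplit y
    have : γ (κ (γ y')) + κ (γ (γ y')) = s := by
      rw [← hy, map_add, map_add, hS s' hs', hγγ, hγγ, map_zero, add_zero, zero_add, zero_add]
    have h0 := hdisj (γ y') (by rw [this]; exact s.2)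
    exact Subtype.ext (this.symm.trans h0)
  -- If `γ x = 0` and `x = s + N y`, then `N (γ y) = γ (N y) = 0`, so `γ y ∈ S`, `κ (γ y) = 0` and
  -- `x = s + γ (κ y)`.
  · intro c
    obtain ⟨⟨x, hx⟩, rfl⟩ := Submodule.Quotient.mk_surjective _ c
    rw [LinearMap.mem_ker] at hx
    obtain ⟨s, hs, y, hy⟩ := hsplit x
    refine ⟨⟨s, hs⟩, ?_⟩
    rw [hf]
    refine (Submodule.Quotient.eq _).2 ?_
    have h1 : γ (κ (γ y)) = 0 := by
      have := congrArg γ hy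
      rw [map_add, map_add, hx, hS s hs, hγγ, zero_add, zero_add] at this
      exact this.symm
    have h2 : κ (γ y) = 0 := hκ _ (hker _ (by rw [h1, hγγ, map_zero, add_zero]))
    refine ⟨-κ y, ?_⟩
    change γ (-κ y) = s - x
    rw [hy, h2, map_neg]; abel

/-- If `N` preserves the summands of a direct sum and is injective on those of positive degree, then
everything which `N` maps to the summand of degree `0` lies there. -/
theorem mem_zero_of_iSupIndep {V : Type} [AddCommGroup V] [Module ℝ V] (p : ℕ → Submodule ℝ V)
    (hp : iSupIndep p) (htop : ⨆ k, p k = ⊤) (N : V →ₗ[ℝ] V) (hN : ∀ k, ∀ x ∈ p k, N x ∈ p k)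
    (hinj : ∀ k, 1 ≤ k → ∀ x ∈ p k, N x = 0 → x = 0) {x : V} (hx : N x ∈ p 0) : x ∈ p 0 := by
  classical
  have hφ := hp.dfinsupp_lsum_injective
  set φ := (DFinsupp.lsum ℕ) fun k => (p k).subtype with hφdef
  have hsurj : x ∈ ⨆ k, p k := htop ▸ Submodule.mem_top
  obtain ⟨f, rfl⟩ := (Submodule.mem_iSup_iff_exists_dfinsupp p x).1 hsurj
  let Nk : ∀ k, p k →ₗ[ℝ] p k := fun k => N.restrict (hN k)
  have h1 : N ∘ₗ φ = φ ∘ₗ DFinsupp.mapRange.linearMap Nk := by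
    refine DFinsupp.lhom_ext fun k y => ?_
    simp [hφdef, Nk]
  have h2 : DFinsupp.mapRange.linearMap Nk f = DFinsupp.single 0 ⟨N (φ f), hx⟩ := by
    apply hφ
    rw [← LinearMap.comp_apply, ← h1]
    simp [hφdef]
  have h3 : f = DFinsupp.single 0 (f 0) := by
    ext k
    rcases Nat.eq_zero_or_pos k with rfl | hk
    · simp
    · have h4 : Nk k (f k) = 0 := by
        have := DFunLike.congr_fun h2 k
        rwa [DFinsupp.mapRange.linearMap_apply, DFinsupp.mapRange_apply,
          DFinsupp.single_eq_of_ne (by omega)] at this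
      rw [DFinsupp.single_eq_of_ne (by omega)]
      exact hinj k hk _ (f k).2 (congrArg Subtype.val h4)
  change φ f ∈ p 0
  rw [h3]
  simp [hφdef]

end Abstract

/-! ### Linear maps of the coefficients -/

section Splitting

variable {n : ℕ} {R : Type} [CommRing R] [Algebra ℝ R]

/-- The extension to local functions of a linear map of coefficients. -/
def coeffMap (n : ℕ) (T : R →ₗ[ℝ] R) : LocalFunction n R →ₗ[ℝ] LocalFunction n R :=
  TensorProduct.map T LinearMap.id

/-- The local functions which do not involve the undifferentiated `h_{μν}`. -/
def constants (n : ℕ) (R : Type) [CommRing R] [Algebra ℝ R] : Subalgebra ℝ (LocalFunction n R) :=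
  (Algebra.TensorProduct.includeRight : JetPoly n →ₐ[ℝ] LocalFunction n R).range

theorem ofEven_mem_constants (v : EvenVar n) : ofEven R v ∈ constants n R := ⟨_, rfl⟩

theorem ofGrass_mem_constants (m : OddVar n →₀ ℝ) : ofGrass R m ∈ constants n R := ⟨_, rfl⟩

theorem properJets_le_constants :
    properJets n R ≤ Subalgebra.toSubmodule (constants n R) := by
  rw [properJets, Submodule.span_le]
  rintro _ ⟨J, hJ, p, rfl⟩
  exact ofEven_mem_constants _

theorem coeffMap_mul (T : R →ₗ[ℝ] R) (r : R) {s : LocalFunction n R} (hs : s ∈ constants n R) :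
    coeffMap n T (ofCoeff n r * s) = ofCoeff n (T r) * s := by
  obtain ⟨j, rfl⟩ := hs
  simp [coeffMap, ofCoeff]

theorem coeffMap_constants (T : R →ₗ[ℝ] R) {s : LocalFunction n R} (hs : s ∈ constants n R) :
    coeffMap n T s = ofCoeff n (T 1) * s := by
  have := coeffMap_mul T 1 hs
  rwa [ofCoeff, ← Algebra.TensorProduct.one_def, one_mul] at this

theorem coeffMap_coeffMap (T U : R →ₗ[ℝ] R) (x : LocalFunction n R) :
    coeffMap n T (coeffMap n U x) = coeffMap n (T ∘ₗ U) x := by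
  rw [coeffMap, coeffMap, ← LinearMap.comp_apply, ← TensorProduct.map_comp]
  rfl

variable (D : Derivation ℝ R R)

theorem coeffMap_derivation_constants {s : LocalFunction n R} (hs : s ∈ constants n R) :
    coeffMap n (D : R →ₗ[ℝ] R) s = 0 := by
  rw [coeffMap_constants _ hs]; simp [ofCoeff]

theorem coeffMap_ofCoeff (T : R →ₗ[ℝ] R) (r : R) :
    coeffMap n T (ofCoeff n r) = ofCoeff n (T r) := rfl

theorem coeffMap_derivation_mul (x y : LocalFunction n R) :
    coeffMap n (D : R →ₗ[ℝ] R) (x * y) =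
      coeffMap n (D : R →ₗ[ℝ] R) x * y + x * coeffMap n (D : R →ₗ[ℝ] R) y := by
  induction x using TensorProduct.induction_on with
  | zero => simp
  | add a b ha hb => rw [add_mul, map_add, ha, hb, map_add, add_mul, add_mul]; abel
  | tmul r j =>
    induction y using TensorProduct.induction_on with
    | zero => simp
    | add a b ha hb => rw [mul_add, map_add, ha, hb, map_add, mul_add, mul_add]; abel
    | tmul s i => simp [coeffMap, TensorProduct.add_tmul, mul_comm, add_comm]

end Splitting

/-! ### The Laplacian of the contraction -/

section Contraction

variable {n : ℕ} {R : Type} [CommRing R] [Algebra ℝ R] {coord : Sym2 (Fin n) → R}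
  {par : Sym2 (Fin n) → Derivation ℝ R R} {ev : R →ₐ[ℝ] ℝ} {X : Set (LocalFunction n R)}
  {K : (OddVar n →₀ ℝ) →ₗ[ℝ] LocalFunction n R}

theorem IsPartialInverse.commute (h : IsPartialInverse coord par X K) (m : OddVar n →₀ ℝ)
    (x : LocalFunction n R) : K m * x = x * K m :=
  jets_commute (h.K_mem m) x

/-- The Laplacian `γκ + κγ`. -/
def laplacian (par : Sym2 (Fin n) → Derivation ℝ R R)
    (K : (OddVar n →₀ ℝ) →ₗ[ℝ] LocalFunction n R) (hK : ∀ m x, K m * x = x * K m) :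
    LocalFunction n R →ₗ[ℝ] LocalFunction n R :=
  gamma n par ∘ₗ kappa K hK + kappa K hK ∘ₗ gamma n par

theorem laplacian_apply (hK : ∀ m x, K m * x = x * K m) (x : LocalFunction n R) :
    laplacian par K hK x = gamma n par (kappa K hK x) + kappa K hK (gamma n par x) := rfl

theorem gamma_one : gamma n par 1 = 0 := by
  simpa [ofCoeff, ← Algebra.TensorProduct.one_def] using gamma_ofCoeff par (n := n) (1 : R)

theorem laplacian_one (hK : ∀ m x, K m * x = x * K m) : laplacian par K hK 1 = 0 := by
  rw [laplacian_apply, kappa_one, gamma_one, map_zero, map_zero, add_zero]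

theorem laplacian_ofCoeff_mul (h : IsPartialInverse coord par X K) (r : R)
    (x : LocalFunction n R) :
    laplacian par K h.commute (ofCoeff n r * x) =
      ofCoeff n (euler coord par r) * x + ofCoeff n r * laplacian par K h.commute x := by
  have h1 : ofCoeff n (euler coord par r) =
      ∑ p, ofCoeff n (par p r) * ofCoeff n (coord p) := by
    rw [euler_apply, ofCoeff, TensorProduct.sum_tmul]
    refine Finset.sum_congr rfl fun p _ => ?_
    rw [← ofCoeff_mul, mul_comm]; rfl
  rw [laplacian_apply, laplacian_apply, kappa_ofCoeff_mul, gamma_ofCoeff_mul, gamma_ofCoeff_mul,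
    map_add, kappa_ofCoeff_mul, h1, gamma_ofCoeff]
  simp only [Finset.sum_mul, map_sum, mul_assoc, kappa_ofCoeff_mul, kappa_ofGrass_mul,
    h.K_gamma_zero, mul_sub, Finset.sum_sub_distrib, mul_add]
  abel

theorem laplacian_ofEven_mul (hK : ∀ m x, K m * x = x * K m) (v : EvenVar n)
    (x : LocalFunction n R) :
    laplacian par K hK (ofEven R v * x) = K (evenVec v) * x + ofEven R v * laplacian par K hK x := by
  rw [laplacian_apply, laplacian_apply, kappa_ofEven_mul, gamma_ofEven_mul, gamma_ofEven_mul,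
    map_add, kappa_ofEven_mul, gamma_ofEven', kappa_ofGrass_mul, mul_add]
  abel

theorem laplacian_ofGrass_mul (h : IsPartialInverse coord par X K) (m : OddVar n →₀ ℝ)
    (x : LocalFunction n R) :
    laplacian par K h.commute (ofGrass R m * x) =
      gamma n par (K m) * x + ofGrass R m * laplacian par K h.commute x := by
  rw [laplacian_apply, laplacian_apply, kappa_ofGrass_mul, gamma_ofGrass_mul, map_sub,
    gamma_jets_mul par (h.K_mem m), gamma_ofGrass_mul, map_neg, kappa_ofGrass_mul, mul_add]
  abel

theorem laplacian_ofCoeff (h : IsPartialInverse coord par X K) (r : R) :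
    laplacian par K h.commute (ofCoeff n r) = ofCoeff n (euler coord par r) := by
  simpa [laplacian_one] using laplacian_ofCoeff_mul h r 1

theorem laplacian_ofEven (hK : ∀ m x, K m * x = x * K m) (v : EvenVar n) :
    laplacian par K hK (ofEven R v) = K (evenVec v) := by
  simpa [laplacian_one] using laplacian_ofEven_mul (par := par) hK v 1

theorem laplacian_ofGrass (h : IsPartialInverse coord par X K) (m : OddVar n →₀ ℝ) :
    laplacian par K h.commute (ofGrass R m) = gamma n par (K m) := by
  simpa [laplacian_one] using laplacian_ofGrass_mul h m 1

theorem laplacian_mul (h : IsPartialInverse coord par X K) (x y : LocalFunction n R) :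
    laplacian par K h.commute (x * y) =
      laplacian par K h.commute x * y + x * laplacian par K h.commute y := by
  refine leibniz_of_generators _ (laplacian_one _) ?_ x y
  rintro _ ((⟨r, rfl⟩ | ⟨v, rfl⟩) | ⟨m, rfl⟩) x
  · rw [laplacian_ofCoeff_mul h, laplacian_ofCoeff h]
  · rw [laplacian_ofEven_mul, laplacian_ofEven]
  · rw [laplacian_ofGrass_mul h, laplacian_ofGrass h]

/-- The part of the Laplacian which does not differentiate the coefficients. It counts the
contractible variables. -/
def counting (coord : Sym2 (Fin n) → R) (par : Sym2 (Fin n) → Derivation ℝ R R)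
    (K : (OddVar n →₀ ℝ) →ₗ[ℝ] LocalFunction n R) (hK : ∀ m x, K m * x = x * K m) :
    LocalFunction n R →ₗ[ℝ] LocalFunction n R :=
  laplacian par K hK - coeffMap n (euler coord par : R →ₗ[ℝ] R)

theorem laplacian_eq (hK : ∀ m x, K m * x = x * K m) (x : LocalFunction n R) :
    laplacian par K hK x =
      coeffMap n (euler coord par : R →ₗ[ℝ] R) x + counting coord par K hK x := by
  simp [counting]

theorem counting_mul (h : IsPartialInverse coord par X K) (x y : LocalFunction n R) :
    counting coord par K h.commute (x * y) =
      counting coord par K h.commute x * y + x * counting coord par K h.commute y := by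
  simp only [counting, LinearMap.sub_apply, laplacian_mul h, coeffMap_derivation_mul, sub_mul,
    mul_sub]
  abel

theorem counting_ofCoeff (h : IsPartialInverse coord par X K) (r : R) :
    counting coord par K h.commute (ofCoeff n r) = 0 := by
  rw [counting, LinearMap.sub_apply, laplacian_ofCoeff h, coeffMap_ofCoeff]
  exact sub_self _

theorem counting_constants (hK : ∀ m x, K m * x = x * K m) {s : LocalFunction n R}
    (hs : s ∈ constants n R) : counting coord par K hK s = laplacian par K hK s := by
  rw [counting, LinearMap.sub_apply, coeffMap_derivation_constants _ hs, sub_zero]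

/-- The subalgebra generated by `X`, the antifields and the ghosts of lowest order. -/
def invariants (X : Set (LocalFunction n R)) : Subalgebra ℝ (LocalFunction n R) :=
  Algebra.adjoin ℝ (X ∪ antifields n R ∪ ghosts n R)

theorem antifields_ghosts_cases {x : LocalFunction n R} (hx : x ∈ antifields n R ∪ ghosts n R) :
    (∃ m ∈ inertVecs n, x = ofGrass R m) ∨ ∃ v, evenVec v = 0 ∧ x = ofEven R v := by
  rcases hx with ((⟨μ, ν, J, rfl⟩ | ⟨μ, J, rfl⟩) | ⟨J, rfl⟩) |
    (((⟨μ, rfl⟩ | ⟨μ, ν, rfl⟩) | rfl) | ⟨μ, rfl⟩)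
  · exact .inl ⟨_, .inl ⟨μ, ν, J, rfl⟩, rfl⟩
  · exact .inr ⟨_, rfl, rfl⟩
  · exact .inr ⟨_, rfl, rfl⟩
  · exact .inl ⟨_, .inr (.inl (.inl (.inl ⟨μ, rfl⟩))), rfl⟩
  · refine .inl ⟨_, .inr (.inl (.inl (.inr ⟨μ, ν, rfl⟩))), ?_⟩
    rw [ofGrass_eq, map_smul, map_sub]
    rfl
  · exact .inl ⟨_, .inr (.inl (.inr rfl)), rfl⟩
  · exact .inl ⟨_, .inr (.inr ⟨μ, rfl⟩), rfl⟩

theorem antifields_ghosts_subset :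
    antifields n R ∪ ghosts n R ⊆ (constants n R : Set (LocalFunction n R)) := by
  intro x hx
  rcases antifields_ghosts_cases hx with ⟨m, -, rfl⟩ | ⟨v, -, rfl⟩
  exacts [ofGrass_mem_constants m, ofEven_mem_constants v]

theorem invariants_le_constants (h : IsPartialInverse coord par X K) :
    invariants X ≤ constants n R := by
  refine Algebra.adjoin_le ?_
  rw [Set.union_assoc]
  exact Set.union_subset (fun x hx => properJets_le_constants (h.X_subset hx))
    antifields_ghosts_subset

/-- `γ` vanishes on the invariants. -/
theorem gamma_invariants (h : IsPartialInverse coord par X K) {s : LocalFunction n R}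
    (hs : s ∈ invariants X) : gamma n par s = 0 := by
  -- Invariants need not have a parity, so that the Leibniz rule is replaced by this statement.
  have key : ∀ x, gamma n par x = 0 → gamma n par (s * x) = 0 := by
    induction hs using Algebra.adjoin_induction with
    | mem s hs =>
      intro x hx
      rw [Set.union_assoc] at hs
      rcases hs with hs | hs
      · rw [gamma_jets_mul par (coord := coord) (Submodule.mem_sup_left (h.X_subset hs)),
          h.gamma_X _ hs, hx]
        simp
      · rcases antifields_ghosts_cases hs with ⟨m, hm, rfl⟩ | ⟨v, hv, rfl⟩
        · rw [gamma_ofGrass_mul, hx]; simp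
        · rw [gamma_ofEven_mul, gamma_ofEven', hv, hx]; simp
    | algebraMap r => intro x hx; simp [Algebra.algebraMap_eq_smul_one, hx]
    | add a b _ _ ha hb => intro x hx; rw [add_mul, map_add, ha x hx, hb x hx, add_zero]
    | mul a b _ _ ha hb => intro x hx; rw [mul_assoc]; exact ha _ (hb x hx)
  simpa using key 1 gamma_one

/-- `κ` vanishes on the invariants. -/
theorem kappa_invariants (h : IsPartialInverse coord par X K) {s : LocalFunction n R}
    (hs : s ∈ invariants X) : kappa K h.commute s = 0 := by
  have key : ∀ x, kappa K h.commute x = 0 → kappa K h.commute (s * x) = 0 := by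
    induction hs using Algebra.adjoin_induction with
    | mem s hs =>
      intro x hx
      rw [Set.union_assoc] at hs
      rcases hs with hs | hs
      · rw [kappa_jets_mul K h.commute (coord := coord) (Submodule.mem_sup_left (h.X_subset hs)), hx]
        simp
      · rcases antifields_ghosts_cases hs with ⟨m, hm, rfl⟩ | ⟨v, hv, rfl⟩
        · rw [kappa_ofGrass_mul, hx, h.K_eq_zero m hm]; simp
        · rw [kappa_ofEven_mul, hx]; simp
    | algebraMap r => intro x hx; simp [Algebra.algebraMap_eq_smul_one, hx]
    | add a b _ _ ha hb => intro x hx; rw [add_mul, map_add, ha x hx, hb x hx, add_zero]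
    | mul a b _ _ ha hb => intro x hx; rw [mul_assoc]; exact ha _ (hb x hx)
  simpa using key 1 (kappa_one _ _)

theorem laplacian_invariants (h : IsPartialInverse coord par X K) {s : LocalFunction n R}
    (hs : s ∈ invariants X) : laplacian par K h.commute s = 0 := by
  rw [laplacian_apply, gamma_invariants h hs, kappa_invariants h hs, map_zero, map_zero, add_zero]

theorem counting_invariants (h : IsPartialInverse coord par X K) {s : LocalFunction n R}
    (hs : s ∈ invariants X) : counting coord par K h.commute s = 0 := by
  rw [counting_constants _ (invariants_le_constants h hs), laplacian_invariants h hs]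

theorem span_le_invariants {Y : Set (LocalFunction n R)}
    (hY : Y ⊆ X ∪ antifields n R ∪ ghosts n R) :
    Submodule.span ℝ Y ≤ Subalgebra.toSubmodule (invariants X) :=
  Submodule.span_le.2 fun _ hx => Algebra.subset_adjoin (hY hx)

/-- A commuting variable other than the undifferentiated `h_{μν}` is itself an invariant, or is mapped
to itself by `K γ` up to an invariant. -/
theorem K_evenVec (h : IsPartialInverse coord par X K) (v : EvenVar n) :
    ∃ s ∈ invariants X, K (evenVec v) = 0 ∧ ofEven R v = s ∨ K (evenVec v) = ofEven R v + s := by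
  cases v with
  | h J hJ p =>
    refine ⟨_, span_le_invariants (fun x hx => .inl (.inl hx)) (h.K_gamma J hJ p), .inr ?_⟩
    rw [evenVec]; abel
  | Cstar J μ =>
    exact ⟨_, Algebra.subset_adjoin (.inl (.inr (.inl (.inr ⟨μ, J, rfl⟩)))), .inl ⟨map_zero K, rfl⟩⟩
  | xistar J =>
    exact ⟨_, Algebra.subset_adjoin (.inl (.inr (.inr ⟨J, rfl⟩))), .inl ⟨map_zero K, rfl⟩⟩

theorem gamma_K_eq (h : IsPartialInverse coord par X K) (m : OddVar n →₀ ℝ) :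
    ∃ s ∈ invariants X, gamma n par (K m) = ofGrass R m + s := by
  refine ⟨_, span_le_invariants ?_ (h.gamma_K m), ?_⟩
  · rw [Set.union_assoc]; exact Set.subset_union_right
  · abel

/-- Every generator is a function of the undifferentiated `h_{μν}`, or the sum of an invariant and
an eigenvector of the counting operator with eigenvalue `1`. -/
theorem generators_cases (h : IsPartialInverse coord par X K) {g : LocalFunction n R}
    (hg : g ∈ generators n R) :
    (∃ r, g = ofCoeff n r) ∨ ∃ s ∈ invariants X, ∃ u,
      counting coord par K h.commute u = u ∧ g = s + u := by
  have key : ∀ g ∈ constants n R, ∀ s ∈ invariants X, laplacian par K h.commute g = g + s →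
      ∃ s ∈ invariants X, ∃ u, counting coord par K h.commute u = u ∧ g = s + u := by
    intro g hg s hs hgs
    refine ⟨-s, neg_mem hs, g + s, ?_, by abel⟩
    rw [map_add, counting_invariants h hs, counting_constants _ hg, hgs, add_zero]
  rcases hg with (⟨r, rfl⟩ | ⟨v, rfl⟩) | ⟨m, rfl⟩
  · exact .inl ⟨r, rfl⟩
  · obtain ⟨s, hs, ⟨h0, rfl⟩ | h1⟩ := K_evenVec h v
    · exact .inr ⟨_, hs, 0, map_zero _, (add_zero _).symm⟩
    · exact .inr (key _ (ofEven_mem_constants v) s hs ((laplacian_ofEven _ v).trans h1))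
  · obtain ⟨s, hs, h1⟩ := gamma_K_eq h m
    exact .inr (key _ (ofGrass_mem_constants m) s hs ((laplacian_ofGrass h m).trans h1))

/-- The counting operator commutes with the Euler operator of the coefficients. -/
theorem counting_comm (h : IsPartialInverse coord par X K) (x : LocalFunction n R) :
    counting coord par K h.commute (coeffMap n (euler coord par : R →ₗ[ℝ] R) x) =
      coeffMap n (euler coord par : R →ₗ[ℝ] R) (counting coord par K h.commute x) := by
  set E := coeffMap n (euler coord par : R →ₗ[ℝ] R) with hE
  set M := counting coord par K h.commute with hM
  suffices hz : M ∘ₗ E - E ∘ₗ M = 0 from sub_eq_zero.1 (LinearMap.congr_fun hz x)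
  refine eq_zero_of_generators _ (fun x y => ?_) ?_
  · simp only [LinearMap.sub_apply, LinearMap.comp_apply, hE, hM, coeffMap_derivation_mul,
      counting_mul h, map_add, sub_mul, mul_sub]
    abel
  · have key : ∀ g ∈ constants n R, ∀ s ∈ invariants X, M g = g + s → (M ∘ₗ E - E ∘ₗ M) g = 0 := by
      intro g hg s hs hgs
      rw [LinearMap.sub_apply, LinearMap.comp_apply, LinearMap.comp_apply, hgs, map_add,
        hE, coeffMap_derivation_constants _ hg,
        coeffMap_derivation_constants _ (invariants_le_constants h hs)]
      simp
    rintro _ ((⟨r, rfl⟩ | ⟨v, rfl⟩) | ⟨m, rfl⟩)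
    · rw [LinearMap.sub_apply, LinearMap.comp_apply, LinearMap.comp_apply, hM, counting_ofCoeff h,
        hE, coeffMap_ofCoeff, counting_ofCoeff h]
      simp
    · have hv := ofEven_mem_constants (R := R) v
      obtain ⟨s, hs, ⟨h0, rfl⟩ | h1⟩ := K_evenVec h v
      · exact key _ hv _ (neg_mem hs) (by
          rw [hM, counting_constants _ hv, laplacian_ofEven, h0, add_neg_cancel])
      · exact key _ hv s hs ((counting_constants _ hv).trans ((laplacian_ofEven _ v).trans h1))
    · have hm := ofGrass_mem_constants (R := R) m
      obtain ⟨s, hs, h1⟩ := gamma_K_eq h m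
      exact key _ hm s hs ((counting_constants _ hm).trans ((laplacian_ofGrass h m).trans h1))

end Contraction

/-! ### The splitting of the local functions and the cohomology -/

section Grading

variable {n : ℕ} {R : Type} [CommRing R] [Algebra ℝ R] {coord : Sym2 (Fin n) → R}
  {par : Sym2 (Fin n) → Derivation ℝ R R} {ev : R →ₐ[ℝ] ℝ} {X : Set (LocalFunction n R)}
  {K : (OddVar n →₀ ℝ) →ₗ[ℝ] LocalFunction n R}

/-- The span of the products of a function of the undifferentiated `h_{μν}` and an invariant. -/
def coeffInvariants (X : Set (LocalFunction n R)) : Submodule ℝ (LocalFunction n R) :=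
  Submodule.span ℝ {x | ∃ r : R, ∃ s ∈ invariants X, x = ofCoeff n r * s}

/-- The grading of the local functions by the number of contractible variables other than the
undifferentiated `h_{μν}`. The piece of degree `0` is defined by generators rather than as the kernel
of the counting operator, with which it coincides because the pieces span (`iSup_gradingPiece`). -/
def gradingPiece (h : IsPartialInverse coord par X K) : ℕ → Submodule ℝ (LocalFunction n R)
  | 0 => coeffInvariants X
  | k + 1 => Module.End.eigenspace (counting coord par K h.commute) ((k + 1 : ℕ) : ℝ)

theorem counting_coeffInvariants (h : IsPartialInverse coord par X K) {x : LocalFunction n R}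
    (hx : x ∈ coeffInvariants X) : counting coord par K h.commute x = 0 := by
  induction hx using Submodule.span_induction with
  | mem x hx =>
    obtain ⟨r, s, hs, rfl⟩ := hx
    rw [counting_mul h, counting_ofCoeff h, counting_invariants h hs]; simp
  | zero => simp
  | add x y _ _ hx hy => rw [map_add, hx, hy, add_zero]
  | smul c x _ hx => rw [map_smul, hx, smul_zero]

theorem counting_gradingPiece (h : IsPartialInverse coord par X K) (k : ℕ) {x : LocalFunction n R}
    (hx : x ∈ gradingPiece h k) : counting coord par K h.commute x = (k : ℝ) • x := by
  cases k with
  | zero => rw [counting_coeffInvariants h hx]; simp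
  | succ k => exact Module.End.mem_eigenspace_iff.1 hx

theorem mem_gradingPiece (h : IsPartialInverse coord par X K) {k : ℕ} (hk : 1 ≤ k)
    {x : LocalFunction n R} (hx : counting coord par K h.commute x = (k : ℝ) • x) :
    x ∈ gradingPiece h k := by
  cases k with
  | zero => omega
  | succ k => exact Module.End.mem_eigenspace_iff.2 hx

theorem iSupIndep_gradingPiece (h : IsPartialInverse coord par X K) :
    iSupIndep (gradingPiece h) := by
  have h1 := (Module.End.eigenspaces_iSupIndep (counting coord par K h.commute)).comp
    (Nat.cast_injective (R := ℝ))
  exact h1.mono fun k x hx => Module.End.mem_eigenspace_iff.2 (counting_gradingPiece h k hx)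

theorem ofCoeff_mul_coeffInvariants (r : R) {x : LocalFunction n R}
    (hx : x ∈ coeffInvariants X) : ofCoeff n r * x ∈ coeffInvariants X := by
  induction hx using Submodule.span_induction with
  | mem x hx =>
    obtain ⟨r', s, hs, rfl⟩ := hx
    exact Submodule.subset_span ⟨r * r', s, hs, by rw [ofCoeff_mul, mul_assoc]⟩
  | zero => rw [mul_zero]; exact zero_mem _
  | add x y _ _ hx hy => rw [mul_add]; exact add_mem hx hy
  | smul c x _ hx => rw [mul_smul_comm]; exact Submodule.smul_mem _ c hx

theorem invariants_mul_coeffInvariants {s x : LocalFunction n R} (hs : s ∈ invariants X)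
    (hx : x ∈ coeffInvariants X) : s * x ∈ coeffInvariants X := by
  induction hx using Submodule.span_induction with
  | mem x hx =>
    obtain ⟨r, s', hs', rfl⟩ := hx
    exact Submodule.subset_span ⟨r, s * s', mul_mem hs hs', by
      rw [← mul_assoc, ← ofCoeff_commute, mul_assoc]⟩
  | zero => rw [mul_zero]; exact zero_mem _
  | add x y _ _ hx hy => rw [mul_add]; exact add_mem hx hy
  | smul c x _ hx => rw [mul_smul_comm]; exact Submodule.smul_mem _ c hx

theorem invariants_le_coeffInvariants {s : LocalFunction n R} (hs : s ∈ invariants X) :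
    s ∈ coeffInvariants X :=
  Submodule.subset_span ⟨1, s, hs, by rw [ofCoeff, ← Algebra.TensorProduct.one_def, one_mul]⟩

/-- The grading exhausts the local functions: a product with a generator on the left raises the
degree by `0` or `1`. -/
theorem iSup_gradingPiece (h : IsPartialInverse coord par X K) : ⨆ k, gradingPiece h k = ⊤ := by
  set T := ⨆ k, gradingPiece h k with hT
  have hmul : ∀ a : LocalFunction n R, (∀ k, ∀ x ∈ gradingPiece h k, a * x ∈ T) →
      ∀ x ∈ T, a * x ∈ T := by
    intro a ha x hx
    have : T ≤ T.comap (LinearMap.mulLeft ℝ a) := iSup_le fun k x hx => ha k x hx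
    exact this hx
  have hle : ∀ k, gradingPiece h k ≤ T := fun k => le_iSup (gradingPiece h) k
  have hS : ∀ s ∈ invariants X, ∀ x ∈ T, s * x ∈ T := by
    intro s hs
    refine hmul s fun k x hx => ?_
    rcases Nat.eq_zero_or_pos k with rfl | hk
    · exact hle 0 (invariants_mul_coeffInvariants hs hx)
    · refine hle k (mem_gradingPiece h hk ?_)
      rw [counting_mul h, counting_invariants h hs, counting_gradingPiece h k hx, zero_mul,
        zero_add, mul_smul_comm]
  have hg : ∀ g ∈ generators n R, ∀ x ∈ T, g * x ∈ T := by
    intro g hg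
    rcases generators_cases h hg with ⟨r, rfl⟩ | ⟨s, hs, u, hu, rfl⟩
    · refine hmul _ fun k x hx => ?_
      rcases Nat.eq_zero_or_pos k with rfl | hk
      · exact hle 0 (ofCoeff_mul_coeffInvariants r hx)
      · refine hle k (mem_gradingPiece h hk ?_)
        rw [counting_mul h, counting_ofCoeff h, counting_gradingPiece h k hx, zero_mul,
          zero_add, mul_smul_comm]
    · intro x hx
      rw [add_mul]
      refine add_mem (hS s hs x hx) (hmul u (fun k x hx => ?_) x hx)
      refine hle (k + 1) (mem_gradingPiece h (by omega) ?_)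
      rw [counting_mul h, hu, counting_gradingPiece h k hx, mul_smul_comm]
      push_cast
      rw [add_smul, one_smul, add_comm]
  have hall : ∀ a ∈ Algebra.adjoin ℝ (generators n R), ∀ x ∈ T, a * x ∈ T := by
    intro a ha
    induction ha using Algebra.adjoin_induction with
    | mem g h => exact hg g h
    | algebraMap r => intro x hx; rw [← Algebra.smul_def]; exact T.smul_mem r hx
    | add a b _ _ ha hb => intro x hx; rw [add_mul]; exact add_mem (ha x hx) (hb x hx)
    | mul a b _ _ ha hb => intro x hx; rw [mul_assoc]; exact ha _ (hb x hx)
  rw [eq_top_iff]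
  rintro x -
  have := hall x (by rw [adjoin_generators]; trivial) 1
    (hle 0 (invariants_le_coeffInvariants (one_mem _)))
  rwa [mul_one] at this

/-- The evaluation of the coefficients at the origin, as an endomorphism of the coefficients. -/
def evalZero (ev : R →ₐ[ℝ] ℝ) : R →ₗ[ℝ] R := Algebra.linearMap ℝ R ∘ₗ ev.toLinearMap

theorem coeffMap_evalZero_mul (ev : R →ₐ[ℝ] ℝ) (r : R) {s : LocalFunction n R}
    (hs : s ∈ constants n R) :
    coeffMap n (evalZero ev) (ofCoeff n r * s) = ev r • s := by
  rw [coeffMap_mul _ _ hs]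
  have : ofCoeff n (evalZero ev r) = ev r • (1 : LocalFunction n R) := by
    rw [ofCoeff, evalZero, LinearMap.comp_apply, Algebra.linearMap_apply,
      Algebra.algebraMap_eq_smul_one, ← TensorProduct.smul_tmul', ← Algebra.TensorProduct.one_def]
    rfl
  rw [this, smul_mul_assoc, one_mul]

theorem coeffMap_evalZero_invariants (h : IsPartialInverse coord par X K) {s : LocalFunction n R}
    (hs : s ∈ invariants X) : coeffMap n (evalZero ev) s = s := by
  have := coeffMap_evalZero_mul ev 1 (invariants_le_constants h hs)
  rwa [ofCoeff, ← Algebra.TensorProduct.one_def, one_mul, map_one, one_smul] at this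

theorem coeffMap_evalZero_mem (h : IsPartialInverse coord par X K) {x : LocalFunction n R}
    (hx : x ∈ coeffInvariants X) : coeffMap n (evalZero ev) x ∈ invariants X := by
  induction hx using Submodule.span_induction with
  | mem x hx =>
    obtain ⟨r, s, hs, rfl⟩ := hx
    rw [coeffMap_evalZero_mul ev r (invariants_le_constants h hs)]
    exact (invariants X).smul_mem hs _
  | zero => rw [map_zero]; exact zero_mem _
  | add x y _ _ hx hy => rw [map_add]; exact add_mem hx hy
  | smul c x _ hx => rw [map_smul]; exact (invariants X).smul_mem hx c

theorem coeffMap_mem_coeffInvariants (h : IsPartialInverse coord par X K) (T : R →ₗ[ℝ] R)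
    {x : LocalFunction n R} (hx : x ∈ coeffInvariants X) : coeffMap n T x ∈ coeffInvariants X := by
  induction hx using Submodule.span_induction with
  | mem x hx =>
    obtain ⟨r, s, hs, rfl⟩ := hx
    rw [coeffMap_mul _ _ (invariants_le_constants h hs)]
    exact Submodule.subset_span ⟨_, s, hs, rfl⟩
  | zero => rw [map_zero]; exact zero_mem _
  | add x y _ _ hx hy => rw [map_add]; exact add_mem hx hy
  | smul c x _ hx => rw [map_smul]; exact Submodule.smul_mem _ c hx

theorem evalZero_euler (hR : IsContractibleCoeff coord par ev) :
    evalZero ev ∘ₗ (euler coord par : R →ₗ[ℝ] R) = 0 := by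
  refine LinearMap.ext fun r => ?_
  have : ev (euler coord par r) = 0 := by
    rw [euler_apply, map_sum]
    exact Finset.sum_eq_zero fun p _ => by rw [map_mul, hR.ev_coord, zero_mul]
  change algebraMap ℝ R (ev (euler coord par r)) = 0
  rw [this, map_zero]

/-- A left inverse of the Euler operator, up to the value at the origin. -/
theorem exists_euler_left_inverse (hR : IsContractibleCoeff coord par ev) :
    ∃ G : R →ₗ[ℝ] R, G ∘ₗ (euler coord par : R →ₗ[ℝ] R) = LinearMap.id - evalZero ev := by
  let V := LinearMap.ker ev.toLinearMap
  have hker : LinearMap.ker ((euler coord par : R →ₗ[ℝ] R) ∘ₗ V.subtype) = ⊥ := by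
    rw [LinearMap.ker_eq_bot']
    rintro ⟨r, hr⟩ h0
    have h1 := hR.euler_ker r h0
    have hr' : ev r = 0 := hr
    rw [hr', map_zero] at h1
    exact Subtype.ext h1
  obtain ⟨g, hg⟩ := LinearMap.exists_leftInverse_of_injective _ hker
  refine ⟨V.subtype ∘ₗ g, LinearMap.ext fun r => ?_⟩
  have hV : r - algebraMap ℝ R (ev r) ∈ V := by
    rw [LinearMap.mem_ker]
    simp
  have h2 := LinearMap.congr_fun hg ⟨_, hV⟩
  have h3 : euler coord par (r - algebraMap ℝ R (ev r)) = euler coord par r := by simp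
  simp only [LinearMap.comp_apply, Submodule.subtype_apply] at h2
  change ((g (euler coord par r) : V) : R) = r - algebraMap ℝ R (ev r)
  rw [← h3]
  exact congrArg Subtype.val h2

/-- On the piece of degree `0`, the Euler operator has all elements which vanish at the origin in its
image. -/
theorem coeffMap_euler_range (hR : IsContractibleCoeff coord par ev)
    (h : IsPartialInverse coord par X K) {x : LocalFunction n R} (hx : x ∈ coeffInvariants X) :
    ∃ y ∈ coeffInvariants X,
      x = coeffMap n (evalZero ev) x + coeffMap n (euler coord par : R →ₗ[ℝ] R) y := by
  induction hx using Submodule.span_induction with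
  | mem x hx =>
    obtain ⟨r, s, hs, rfl⟩ := hx
    obtain ⟨r', hr'⟩ := hR.euler_range r
    refine ⟨ofCoeff n r' * s, Submodule.subset_span ⟨r', s, hs, rfl⟩, ?_⟩
    rw [coeffMap_mul _ _ (invariants_le_constants h hs),
      coeffMap_mul _ _ (invariants_le_constants h hs), ← add_mul, ofCoeff, ofCoeff, ofCoeff,
      ← TensorProduct.add_tmul]
    congr 2
    change r = algebraMap ℝ R (ev r) + euler coord par r'
    rw [hr']; abel
  | zero => exact ⟨0, zero_mem _, by simp⟩
  | add x y _ _ hx hy =>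
    obtain ⟨x', hx', ex⟩ := hx
    obtain ⟨y', hy', ey⟩ := hy
    refine ⟨x' + y', add_mem hx' hy', ?_⟩
    nth_rewrite 1 [ex, ey]
    rw [map_add, map_add]; abel
  | smul c x _ hx =>
    obtain ⟨x', hx', ex⟩ := hx
    refine ⟨c • x', Submodule.smul_mem _ c hx', ?_⟩
    nth_rewrite 1 [ex]
    rw [map_smul, map_smul, smul_add]

/-- `E + k` is invertible on local functions for `k ≥ 1`. -/
theorem coeffMap_euler_add_bijective (hR : IsContractibleCoeff coord par ev) {k : ℕ} (hk : 1 ≤ k) :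
    Function.Bijective fun x : LocalFunction n R =>
      coeffMap n (euler coord par : R →ₗ[ℝ] R) x + (k : ℝ) • x := by
  let T : R →ₗ[ℝ] R := (euler coord par : R →ₗ[ℝ] R) + (k : ℝ) • LinearMap.id
  let e : R ≃ₗ[ℝ] R := LinearEquiv.ofBijective T (hR.euler_add_bijective k hk)
  have h1 : (fun x : LocalFunction n R =>
      coeffMap n (euler coord par : R →ₗ[ℝ] R) x + (k : ℝ) • x) =
      TensorProduct.congr e (LinearEquiv.refl ℝ (JetPoly n)) := by
    funext x
    change _ = TensorProduct.map T LinearMap.id x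
    rw [TensorProduct.map_add_left, TensorProduct.map_smul_left, TensorProduct.map_id]
    rfl
  rw [h1]
  exact (TensorProduct.congr e (LinearEquiv.refl ℝ (JetPoly n))).bijective

theorem laplacian_gradingPiece (h : IsPartialInverse coord par X K) (k : ℕ) {x : LocalFunction n R}
    (hx : x ∈ gradingPiece h k) : laplacian par K h.commute x =
      coeffMap n (euler coord par : R →ₗ[ℝ] R) x + (k : ℝ) • x := by
  rw [laplacian_eq (coord := coord), counting_gradingPiece h k hx]

theorem laplacian_mem_gradingPiece (h : IsPartialInverse coord par X K) (k : ℕ)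
    {x : LocalFunction n R} (hx : x ∈ gradingPiece h k) :
    laplacian par K h.commute x ∈ gradingPiece h k := by
  rw [laplacian_gradingPiece h k hx]
  refine add_mem ?_ (Submodule.smul_mem _ _ hx)
  rcases Nat.eq_zero_or_pos k with rfl | hk
  · exact coeffMap_mem_coeffInvariants h _ hx
  · refine mem_gradingPiece h hk ?_
    rw [counting_comm h, counting_gradingPiece h k hx, map_smul]

/-- The Laplacian is surjective on the pieces of positive degree. -/
theorem exists_laplacian_eq (hR : IsContractibleCoeff coord par ev)
    (h : IsPartialInverse coord par X K) {k : ℕ} (hk : 1 ≤ k) {x : LocalFunction n R}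
    (hx : x ∈ gradingPiece h k) : ∃ y, laplacian par K h.commute y = x := by
  have hb := coeffMap_euler_add_bijective (n := n) hR hk
  obtain ⟨y, hy⟩ := hb.2 x
  refine ⟨y, ?_⟩
  dsimp only at hy
  have hy' : counting coord par K h.commute y = (k : ℝ) • y := by
    -- `M` commutes with `E`, and `E + k` is injective.
    apply hb.1
    dsimp only
    rw [← counting_comm h, ← map_smul (counting coord par K h.commute), ← map_add, hy,
      counting_gradingPiece h k hx, ← hy, map_smul, smul_add]
  rw [laplacian_gradingPiece h k (mem_gradingPiece h hk hy'), hy]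

/-- A partial inverse of `γ` on the variables determines its cohomology, provided that the
coefficients are contractible. -/
theorem IsPartialInverse.cohomologyIsomorphicTo (hR : IsContractibleCoeff coord par ev)
    (h : IsPartialInverse coord par X K) :
    CohomologyIsomorphicTo (gamma n par) (invariants X) := by
  have hzero : ∀ x ∈ coeffInvariants X, laplacian par K h.commute x =
      coeffMap n (euler coord par : R →ₗ[ℝ] R) x := fun x hx => by
    rw [laplacian_gradingPiece h 0 hx]; simp
  have hmem : ∀ x, laplacian par K h.commute x ∈ coeffInvariants X → x ∈ coeffInvariants X :=
    fun x hx => mem_zero_of_iSupIndep _ (iSupIndep_gradingPiece h) (iSup_gradingPiece h) _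
      (fun k x hx => laplacian_mem_gradingPiece h k hx) (fun k hk x hx h0 => by
        rw [laplacian_gradingPiece h k hx] at h0
        exact (coeffMap_euler_add_bijective hR hk).1 (by simpa using h0)) hx
  refine cohomologyIsomorphicTo_of_laplacian (κ := kappa K h.commute) (gamma_gamma hR.par_comm)
    (fun s hs => gamma_invariants h hs) (fun s hs => kappa_invariants h hs) (fun x => ?_)
    (fun x hx => ?_) (fun x hx => ?_)
  · have hx : x ∈ ⨆ k, gradingPiece h k := by rw [iSup_gradingPiece]; trivial
    change ∃ s ∈ invariants X, ∃ y, x = s + laplacian par K h.commute y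
    induction hx using Submodule.iSup_induction' with
    | mem k x hx =>
      rcases Nat.eq_zero_or_pos k with rfl | hk
      · obtain ⟨y, hy, e⟩ := coeffMap_euler_range hR h hx
        exact ⟨_, coeffMap_evalZero_mem h hx, y, by rw [hzero y hy]; exact e⟩
      · obtain ⟨y, hy⟩ := exists_laplacian_eq hR h hk hx
        exact ⟨0, zero_mem _, y, by rw [hy, zero_add]⟩
    | zero => exact ⟨0, zero_mem _, 0, by simp⟩
    | add x y _ _ hx hy =>
      obtain ⟨s, hs, x', rfl⟩ := hx
      obtain ⟨t, ht, y', rfl⟩ := hy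
      exact ⟨s + t, add_mem hs ht, x' + y', by rw [map_add]; abel⟩
  · change laplacian par K h.commute x = 0 at hx
    have h0 := hmem x (by rw [hx]; exact zero_mem _)
    obtain ⟨G, hG⟩ := exists_euler_left_inverse hR
    have h1 := coeffMap_coeffMap (n := n) G (euler coord par : R →ₗ[ℝ] R) x
    have h3 : coeffMap n (LinearMap.id - evalZero ev) = LinearMap.id - coeffMap n (evalZero ev) :=
      (LinearMap.rTensor_sub LinearMap.id (evalZero ev)).trans
        (congrArg (· - _) (LinearMap.rTensor_id (JetPoly n) R))
    rw [← hzero x h0, hx, map_zero, hG, h3] at h1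
    have h2 : x = coeffMap n (evalZero ev) x := (sub_eq_zero.1 h1.symm)
    rw [h2]
    exact coeffMap_evalZero_mem h h0
  · change laplacian par K h.commute x ∈ _ at hx
    change laplacian par K h.commute x = 0
    have h0 := hmem x (invariants_le_coeffInvariants hx)
    have h1 := coeffMap_evalZero_invariants (ev := ev) h hx
    rw [hzero x h0, coeffMap_coeffMap, evalZero_euler hR, coeffMap, TensorProduct.map_zero_left] at h1
    rw [hzero x h0, ← h1]; rfl

end Grading

/-! ### Linearized curvatures of jets with values in a vector space -/

section Curvature

variable {n : ℕ} {V V' : Type} [AddCommGroup V] [Module ℝ V] [AddCommGroup V'] [Module ℝ V']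

/-- The Riemann tensor of a jet `H_{μν}`. -/
def riem (H : Fin n → Fin n → Jet n V) (α β μ ν : Fin n) : Jet n V := fun J =>
  (-(1 / 2) : ℝ) • (H β ν (α ::ₘ μ ::ₘ J) + H α μ (β ::ₘ ν ::ₘ J) - H β μ (α ::ₘ ν ::ₘ J)
    - H α ν (β ::ₘ μ ::ₘ J))

/-- The Ricci tensor of a jet `H_{μν}`. -/
def ric (H : Fin n → Fin n → Jet n V) (μ ν : Fin n) : Jet n V := fun J =>
  ∑ α, eta α α • riem H α μ α ν J

/-- The scalar curvature of a jet `H_{μν}`. -/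
def scal (H : Fin n → Fin n → Jet n V) : Jet n V := fun J => ∑ μ, eta μ μ • ric H μ μ J

/-- The Schouten tensor of a jet `H_{μν}`. -/
def schou (H : Fin n → Fin n → Jet n V) (μ ν : Fin n) : Jet n V := fun J =>
  (1 / ((n : ℝ) - 2)) • (ric H μ ν J - (1 / (2 * ((n : ℝ) - 1)) * eta μ ν) • scal H J)

/-- The Weyl tensor of a jet `H_{μν}`: the part of the Riemann tensor which is not determined by the
Schouten tensor. -/
def conf (H : Fin n → Fin n → Jet n V) (α β γ δ : Fin n) : Jet n V := fun J =>
  riem H α β γ δ J - (eta α γ • schou H δ β J - eta α δ • schou H γ β J - eta β γ • schou H δ α J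
    + eta β δ • schou H γ α J)

/-- The Cotton tensor of a jet `H_{μν}`. -/
def cott (H : Fin n → Fin n → Jet n V) (α β μ : Fin n) : Jet n V := fun J =>
  schou H β α (μ ::ₘ J) - schou H μ α (β ::ₘ J)

theorem eta_self_mul_self (μ : Fin n) : eta μ μ * eta μ μ = 1 := by
  unfold eta; rw [if_pos rfl]; split_ifs <;> norm_num

theorem eta_of_ne {μ ν : Fin n} (h : μ ≠ ν) : eta μ ν = 0 := if_neg h

/-- Raising an index with `η` and contracting it with `η` is the identity. -/
theorem sum_eta_smul (β : Fin n) (x : Fin n → V) :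
    ∑ α, eta α α • eta α β • x α = x β := by
  rw [Finset.sum_eq_single β]
  · rw [smul_smul, eta_self_mul_self, one_smul]
  · intro α _ h; rw [eta_of_ne h, zero_smul, smul_zero]
  · simp

theorem sum_eta_smul_eta_self (x : V) :
    ∑ α : Fin n, eta α α • eta α α • x = (n : ℝ) • x := by
  simp [smul_smul, eta_self_mul_self, ← Nat.cast_smul_eq_nsmul ℝ]

theorem sum_eta_eta (x : Fin n → V) : ∀ μ, ∑ l, eta μ l • x l = eta μ μ • x μ := by
  intro μ
  rw [Finset.sum_eq_single μ]
  · intro α _ h; rw [eta_of_ne h.symm, zero_smul]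
  · simp

section Map

variable (φ : V →ₗ[ℝ] V') (H : Fin n → Fin n → Jet n V)

theorem map_riem (α β μ ν : Fin n) (J : Multiset (Fin n)) :
    φ (riem H α β μ ν J) = riem (fun μ ν J => φ (H μ ν J)) α β μ ν J := by simp [riem]

theorem map_ric (μ ν : Fin n) (J : Multiset (Fin n)) :
    φ (ric H μ ν J) = ric (fun μ ν J => φ (H μ ν J)) μ ν J := by simp [ric, map_riem]

theorem map_scal (J : Multiset (Fin n)) :
    φ (scal H J) = scal (fun μ ν J => φ (H μ ν J)) J := by simp [scal, map_ric]

theorem map_schou (μ ν : Fin n) (J : Multiset (Fin n)) :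
    φ (schou H μ ν J) = schou (fun μ ν J => φ (H μ ν J)) μ ν J := by
  simp only [schou, map_ric, map_scal, map_smul, map_sub]

theorem map_conf (α β γ δ : Fin n) (J : Multiset (Fin n)) :
    φ (conf H α β γ δ J) = conf (fun μ ν J => φ (H μ ν J)) α β γ δ J := by
  simp only [conf, map_riem, map_schou, map_smul, map_sub, map_add]

theorem map_cott (α β μ : Fin n) (J : Multiset (Fin n)) :
    φ (cott H α β μ J) = cott (fun μ ν J => φ (H μ ν J)) α β μ J := by
  simp only [cott, map_schou, map_sub]

end Map

section Symmetries

variable {H : Fin n → Fin n → Jet n V}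

theorem riem_antisymm_left (α β μ ν : Fin n) (J : Multiset (Fin n)) :
    riem H β α μ ν J = -riem H α β μ ν J := by
  simp only [riem]; module

theorem riem_antisymm_right (α β μ ν : Fin n) (J : Multiset (Fin n)) :
    riem H α β ν μ J = -riem H α β μ ν J := by
  simp only [riem]; module

theorem riem_pair_symm (hH : ∀ μ ν J, H μ ν J = H ν μ J) (α β μ ν : Fin n)
    (J : Multiset (Fin n)) : riem H μ ν α β J = riem H α β μ ν J := by
  simp only [riem]
  rw [hH ν β, hH μ α, hH ν α, hH μ β, Multiset.cons_swap α μ, Multiset.cons_swap β ν,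
    Multiset.cons_swap α ν, Multiset.cons_swap β μ]
  module

/-- The Bianchi identity. -/
theorem riem_bianchi (l α β μ ν : Fin n) (J : Multiset (Fin n)) :
    riem H α β μ ν (l ::ₘ J) + riem H β l μ ν (α ::ₘ J) + riem H l α μ ν (β ::ₘ J) = 0 := by
  have e1 : ∀ a b c : Fin n, a ::ₘ b ::ₘ c ::ₘ J = c ::ₘ b ::ₘ a ::ₘ J := fun a b c => by
    rw [Multiset.cons_swap b c, Multiset.cons_swap a c, Multiset.cons_swap a b]
  simp only [riem]
  rw [e1 l μ α, e1 l ν α, e1 l ν β, e1 l μ β, e1 β μ α, e1 β ν α]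
  module

theorem ric_symm (hH : ∀ μ ν J, H μ ν J = H ν μ J) (μ ν : Fin n) (J : Multiset (Fin n)) :
    ric H μ ν J = ric H ν μ J := by
  simp only [ric]
  exact Finset.sum_congr rfl fun α _ => by rw [riem_pair_symm hH]

theorem schou_symm (hH : ∀ μ ν J, H μ ν J = H ν μ J) (μ ν : Fin n) (J : Multiset (Fin n)) :
    schou H μ ν J = schou H ν μ J := by
  simp only [schou]
  rw [ric_symm hH, eta_comm]

end Symmetries

/-- The change `∂_μ c_ν + ∂_ν c_μ + 2 η_{μν} x` of a jet `H_{μν}` under an infinitesimal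
diffeomorphism and Weyl rescaling. -/
def gauge (c : Fin n → Jet n V) (x : Jet n V) (μ ν : Fin n) : Jet n V := fun J =>
  c ν (μ ::ₘ J) + c μ (ν ::ₘ J) + (2 * eta μ ν) • x J

section Gauge

variable (c : Fin n → Jet n V) (x : Jet n V)

/-- The Riemann tensor is invariant under infinitesimal diffeomorphisms. -/
theorem riem_gauge (α β μ ν : Fin n) (J : Multiset (Fin n)) :
    riem (gauge c x) α β μ ν J = -(eta β ν • x (α ::ₘ μ ::ₘ J) + eta α μ • x (β ::ₘ ν ::ₘ J)
      - eta β μ • x (α ::ₘ ν ::ₘ J) - eta α ν • x (β ::ₘ μ ::ₘ J)) := by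
  have e1 : ∀ a b c : Fin n, a ::ₘ b ::ₘ c ::ₘ J = c ::ₘ b ::ₘ a ::ₘ J := fun a b c => by
    rw [Multiset.cons_swap b c, Multiset.cons_swap a c, Multiset.cons_swap a b]
  have e2 : ∀ a b c : Fin n, a ::ₘ b ::ₘ c ::ₘ J = b ::ₘ a ::ₘ c ::ₘ J := fun a b c => by
    rw [Multiset.cons_swap a b]
  simp only [riem, gauge]
  rw [e2 β α μ, e1 ν α μ, e2 α β ν, e1 μ β ν, e2 β α ν, e1 μ α ν, e2 α β μ, e1 ν β μ]
  module

theorem ric_gauge (μ ν : Fin n) (J : Multiset (Fin n)) :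
    ric (gauge c x) μ ν J =
      -(eta μ ν • ∑ α, eta α α • x (α ::ₘ α ::ₘ J)) - ((n : ℝ) - 2) • x (μ ::ₘ ν ::ₘ J) := by
  have h1 : ∑ α, eta α α • eta μ α • x (α ::ₘ ν ::ₘ J) = x (μ ::ₘ ν ::ₘ J) := by
    simp only [eta_comm μ]; exact sum_eta_smul μ fun α => x (α ::ₘ ν ::ₘ J)
  have h2 : ∑ α, eta α α • eta α ν • x (μ ::ₘ α ::ₘ J) = x (μ ::ₘ ν ::ₘ J) :=
    sum_eta_smul ν fun α => x (μ ::ₘ α ::ₘ J)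
  have h3 := sum_eta_smul_eta_self (n := n) (x (μ ::ₘ ν ::ₘ J))
  simp only [ric, riem_gauge, smul_neg, smul_add, smul_sub, Finset.sum_neg_distrib,
    Finset.sum_add_distrib, Finset.sum_sub_distrib, h1, h2, h3, Finset.smul_sum,
    smul_comm (eta μ ν)]
  module

theorem scal_gauge (J : Multiset (Fin n)) :
    scal (gauge c x) J = (2 - 2 * (n : ℝ)) • ∑ α, eta α α • x (α ::ₘ α ::ₘ J) := by
  have h3 := sum_eta_smul_eta_self (n := n) (∑ α, eta α α • x (α ::ₘ α ::ₘ J))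
  simp only [scal, ric_gauge, smul_neg, smul_sub, Finset.sum_neg_distrib,
    Finset.sum_sub_distrib, h3, smul_comm _ ((n : ℝ) - 2), ← Finset.smul_sum]
  module

theorem schou_gauge (hn : 3 ≤ n) (μ ν : Fin n) (J : Multiset (Fin n)) :
    schou (gauge c x) μ ν J = -x (μ ::ₘ ν ::ₘ J) := by
  have hn' : (3 : ℝ) ≤ n := by exact_mod_cast hn
  have h1 : (n : ℝ) - 1 ≠ 0 := by linarith
  have h2 : (n : ℝ) - 2 ≠ 0 := by linarith
  rw [schou, ric_gauge, scal_gauge]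
  set S := ∑ α, eta α α • x (α ::ₘ α ::ₘ J)
  have e1 : 1 / (2 * ((n : ℝ) - 1)) * eta μ ν * (2 - 2 * n) = -eta μ ν := by field_simp; ring
  have e2 : 1 / ((n : ℝ) - 2) * (n - 2) = 1 := by field_simp
  rw [smul_smul _ _ S, e1]
  have : -(eta μ ν • S) - ((n : ℝ) - 2) • x (μ ::ₘ ν ::ₘ J) - -eta μ ν • S =
      ((n : ℝ) - 2) • (-x (μ ::ₘ ν ::ₘ J)) := by module
  rw [this, smul_smul, e2, one_smul]

theorem conf_gauge (hn : 3 ≤ n) (α β γ δ : Fin n) (J : Multiset (Fin n)) :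
    conf (gauge c x) α β γ δ J = 0 := by
  simp only [conf, riem_gauge, schou_gauge _ _ hn]
  rw [Multiset.cons_swap δ β, Multiset.cons_swap γ β, Multiset.cons_swap δ α,
    Multiset.cons_swap γ α]
  module

theorem cott_gauge (hn : 3 ≤ n) (α β μ : Fin n) (J : Multiset (Fin n)) :
    cott (gauge c x) α β μ J = 0 := by
  simp only [cott, schou_gauge _ _ hn]
  rw [Multiset.cons_swap α μ, Multiset.cons_swap β μ, Multiset.cons_swap α β, sub_self]

end Gauge

section Contractions

variable {H : Fin n → Fin n → Jet n V}

/-- The contracted Bianchi identity. -/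
theorem sum_riem_div (hH : ∀ μ ν J, H μ ν J = H ν μ J) (β γ δ : Fin n) (J : Multiset (Fin n)) :
    ∑ α, eta α α • riem H α β γ δ (α ::ₘ J) = ric H β δ (γ ::ₘ J) - ric H β γ (δ ::ₘ J) := by
  simp only [ric]
  rw [← Finset.sum_sub_distrib]
  refine Finset.sum_congr rfl fun α _ => ?_
  have h := riem_bianchi (H := H) α γ δ α β J
  rw [← smul_sub]
  congr 1
  rw [riem_antisymm_left α δ α β (γ ::ₘ J), riem_pair_symm hH α β α δ,
    riem_pair_symm hH α β γ δ, riem_pair_symm hH α β α γ] at h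
  rw [eq_sub_iff_add_eq, ← sub_eq_zero]
  rw [← h]; abel

/-- The twice contracted Bianchi identity. -/
theorem ric_div (hH : ∀ μ ν J, H μ ν J = H ν μ J) (γ : Fin n) (J : Multiset (Fin n)) :
    ∑ α, eta α α • ric H α γ (α ::ₘ J) = (1 / 2 : ℝ) • scal H (γ ::ₘ J) := by
  have h : ∑ β, eta β β • ∑ α, eta α α • riem H α β γ β (α ::ₘ J) =
      ∑ α, eta α α • ric H α γ (α ::ₘ J) := by
    simp only [Finset.smul_sum, ric]
    rw [Finset.sum_comm]
    refine Finset.sum_congr rfl fun α _ => Finset.sum_congr rfl fun β _ => ?_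
    rw [smul_comm, riem_antisymm_left β α γ β, riem_antisymm_right β α β γ, neg_neg]
  simp only [sum_riem_div hH, smul_sub, Finset.sum_sub_distrib] at h
  have h2 : scal H (γ ::ₘ J) = (2 : ℝ) • ∑ α, eta α α • ric H α γ (α ::ₘ J) := by
    rw [two_smul]
    nth_rewrite 1 [← h]
    rw [sub_add_cancel]
    rfl
  rw [h2, smul_smul]; norm_num

theorem ric_eq_schou (hn : 3 ≤ n) (μ ν : Fin n) (J : Multiset (Fin n)) :
    ric H μ ν J = ((n : ℝ) - 2) • schou H μ ν J +
      (1 / (2 * ((n : ℝ) - 1)) * eta μ ν) • scal H J := by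
  have hn' : (3 : ℝ) ≤ n := by exact_mod_cast hn
  have h2 : (n : ℝ) - 2 ≠ 0 := by linarith
  rw [schou, smul_smul, mul_one_div_cancel h2, one_smul]; abel

theorem schou_div (hH : ∀ μ ν J, H μ ν J = H ν μ J) (hn : 3 ≤ n) (γ : Fin n)
    (J : Multiset (Fin n)) :
    ∑ α, eta α α • schou H α γ (α ::ₘ J) = (1 / (2 * ((n : ℝ) - 1))) • scal H (γ ::ₘ J) := by
  have hn' : (3 : ℝ) ≤ n := by exact_mod_cast hn
  have h1 : (n : ℝ) - 1 ≠ 0 := by linarith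
  have h2 : (n : ℝ) - 2 ≠ 0 := by linarith
  have h3 : ∑ α, eta α α • ((1 / (2 * ((n : ℝ) - 1)) * eta α γ) • scal H (α ::ₘ J)) =
      (1 / (2 * ((n : ℝ) - 1))) • scal H (γ ::ₘ J) := by
    simp only [mul_smul]
    simp only [smul_comm _ (1 / (2 * ((n : ℝ) - 1)))]
    rw [← Finset.smul_sum, sum_eta_smul γ fun α => scal H (α ::ₘ J)]
  simp only [schou, smul_comm _ (1 / ((n : ℝ) - 2)), smul_sub, Finset.sum_sub_distrib]
  simp only [← Finset.smul_sum, ric_div hH, h3]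
  rw [smul_smul, smul_smul, ← sub_smul]
  congr 1
  field_simp
  ring

/-- The divergence of the Weyl tensor is `n - 3` times the Cotton tensor. -/
theorem conf_div (hH : ∀ μ ν J, H μ ν J = H ν μ J) (hn : 3 ≤ n) (β γ δ : Fin n)
    (J : Multiset (Fin n)) :
    ∑ α, eta α α • conf H α β γ δ (α ::ₘ J) = ((n : ℝ) - 3) • cott H β δ γ J := by
  have h1 : ∀ γ δ, ∑ α, eta α α • eta α γ • schou H δ β (α ::ₘ J) = schou H δ β (γ ::ₘ J) :=
    fun γ δ => sum_eta_smul γ fun α => schou H δ β (α ::ₘ J)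
  have h2 : ∀ δ (c : ℝ), ∑ α, eta α α • c • schou H δ α (α ::ₘ J) =
      c • (1 / (2 * ((n : ℝ) - 1))) • scal H (δ ::ₘ J) := fun δ c => by
    rw [← schou_div hH hn, Finset.smul_sum]
    exact Finset.sum_congr rfl fun α _ => by rw [smul_comm, schou_symm hH]
  simp only [conf, smul_sub, smul_add, Finset.sum_sub_distrib, Finset.sum_add_distrib, h1, h2,
    sum_riem_div hH, cott, ric_eq_schou hn]
  rw [schou_symm hH β δ, schou_symm hH β γ]
  module

end Contractions

section ThreeDim

variable {H : Fin 3 → Fin 3 → Jet 3 V}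

theorem eq_zero_of_antisymm {f : Fin 3 → Fin 3 → V} (hf : ∀ a b, f b a = -f a b)
    (h1 : f 0 1 = 0) (h2 : f 0 2 = 0) (h3 : f 1 2 = 0) (a b : Fin 3) : f a b = 0 := by
  have h0 : ∀ a, f a a = 0 := fun a => by
    have h2 : (2 : ℝ) • f a a = 0 := by rw [two_smul]; nth_rewrite 2 [hf]; exact add_neg_cancel _
    exact (smul_eq_zero.1 h2).resolve_left two_ne_zero
  fin_cases a <;> fin_cases b <;> first | exact h0 _ | assumption | exact (hf 0 1).trans (by rw [h1, neg_zero]) |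
    exact (hf 0 2).trans (by rw [h2, neg_zero]) | exact (hf 1 2).trans (by rw [h3, neg_zero])

theorem conf_antisymm_left {n : ℕ} {H : Fin n → Fin n → Jet n V} (α β γ δ : Fin n)
    (J : Multiset (Fin n)) : conf H β α γ δ J = -conf H α β γ δ J := by
  simp only [conf]; rw [riem_antisymm_left]; module

theorem conf_antisymm_right {n : ℕ} {H : Fin n → Fin n → Jet n V} (α β γ δ : Fin n)
    (J : Multiset (Fin n)) : conf H α β δ γ J = -conf H α β γ δ J := by
  simp only [conf]; rw [riem_antisymm_right]; module

/-- The Weyl tensor vanishes in three dimensions. -/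
theorem conf_three (hH : ∀ μ ν J, H μ ν J = H ν μ J) (α β γ δ : Fin 3) (J : Multiset (Fin 3)) :
    conf H α β γ δ J = 0 := by
  have hz : ∀ a μ ν, riem H a a μ ν J = 0 := fun a μ ν => by simp [riem]
  have hz' : ∀ a μ ν, riem H μ ν a a J = 0 := fun a μ ν => by simp [riem]
  have e1 : ∀ μ ν, riem H 1 0 μ ν J = -riem H 0 1 μ ν J := fun μ ν => riem_antisymm_left ..
  have e2 : ∀ μ ν, riem H 2 0 μ ν J = -riem H 0 2 μ ν J := fun μ ν => riem_antisymm_left ..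
  have e3 : ∀ μ ν, riem H 2 1 μ ν J = -riem H 1 2 μ ν J := fun μ ν => riem_antisymm_left ..
  have e1' : ∀ μ ν, riem H μ ν 1 0 J = -riem H μ ν 0 1 J := fun μ ν => riem_antisymm_right ..
  have e2' : ∀ μ ν, riem H μ ν 2 0 J = -riem H μ ν 0 2 J := fun μ ν => riem_antisymm_right ..
  have e3' : ∀ μ ν, riem H μ ν 2 1 J = -riem H μ ν 1 2 J := fun μ ν => riem_antisymm_right ..
  have p1 : riem H 0 2 0 1 J = riem H 0 1 0 2 J := riem_pair_symm hH ..
  have p2 : riem H 1 2 0 1 J = riem H 0 1 1 2 J := riem_pair_symm hH ..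
  have p3 : riem H 1 2 0 2 J = riem H 0 2 1 2 J := riem_pair_symm hH ..
  have d0 : eta (0 : Fin 3) 0 = -1 := by simp [eta]
  have d1 : eta (1 : Fin 3) 1 = 1 := by simp [eta]
  have d2 : eta (2 : Fin 3) 2 = 1 := if_pos rfl
  have o1 : eta (0 : Fin 3) 1 = 0 := eta_of_ne (by decide)
  have o2 : eta (0 : Fin 3) 2 = 0 := eta_of_ne (by decide)
  have o3 : eta (1 : Fin 3) 2 = 0 := eta_of_ne (by decide)
  have o1' : eta (1 : Fin 3) 0 = 0 := eta_of_ne (by decide)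
  have o2' : eta (2 : Fin 3) 0 = 0 := eta_of_ne (by decide)
  have o3' : eta (2 : Fin 3) 1 = 0 := eta_of_ne (by decide)
  -- It suffices to treat the independent pairs `01`, `02`, `12`, where all Riemann components are
  -- expressed by the six independent ones.
  refine eq_zero_of_antisymm (f := fun α β => conf H α β γ δ J)
    (fun a b => conf_antisymm_left ..) ?_ ?_ ?_ α β
  all_goals
    refine eq_zero_of_antisymm (f := fun γ δ => conf H _ _ γ δ J)
      (fun a b => conf_antisymm_right ..) ?_ ?_ ?_ γ δ
  all_goals
    simp only [conf, schou, scal, ric, Fin.sum_univ_three, hz, hz', e1, e2, e3, e1', e2',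
      e3', p1, p2, p3, d0, d1, d2, o1, o2, o3, o1', o2', o3']
    norm_num
  all_goals module

end ThreeDim

end Curvature

/-! ### Inverting `γ` on the jet variables -/

section Pick

variable {n : ℕ} {V V' : Type} [AddCommGroup V]

open Classical in
/-- The value `f a b J'` for a choice of a decomposition `J = {a, b} + J'`, and `0` if there is
none. -/
def pick (f : Fin n → Fin n → Multiset (Fin n) → V) (J : Multiset (Fin n)) : V :=
  if h : ∃ a b J', J = a ::ₘ b ::ₘ J' then
    f h.choose h.choose_spec.choose h.choose_spec.choose_spec.choose else 0

theorem pick_cases (f : Fin n → Fin n → Multiset (Fin n) → V) (J : Multiset (Fin n)) :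
    (∃ a b J', J = a ::ₘ b ::ₘ J' ∧ pick f J = f a b J') ∨
      (¬∃ a b J', J = a ::ₘ b ::ₘ J') ∧ pick f J = 0 := by
  by_cases h : ∃ a b J', J = a ::ₘ b ::ₘ J'
  · exact .inl ⟨_, _, _, h.choose_spec.choose_spec.choose_spec, dif_pos h⟩
  · exact .inr ⟨h, dif_neg h⟩

theorem pick_eq_zero (f : Fin n → Fin n → Multiset (Fin n) → V) {J : Multiset (Fin n)}
    (hJ : J.card ≤ 1) : pick f J = 0 := by
  rcases pick_cases f J with ⟨a, b, J', rfl, -⟩ | ⟨-, h⟩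
  · simp at hJ
  · exact h

theorem eq_of_exchange {g : Fin n → Multiset (Fin n) → V'}
    (hg : ∀ a c J, g a (c ::ₘ J) = g c (a ::ₘ J)) {a a' : Fin n} {J J' : Multiset (Fin n)}
    (h : a ::ₘ J = a' ::ₘ J') : g a J = g a' J' := by
  rcases Multiset.cons_eq_cons.1 h with ⟨rfl, rfl⟩ | ⟨-, cs, rfl, rfl⟩
  · rfl
  · exact hg _ _ _

/-- If `f a b J` is symmetric in `a`, `b` and in exchanges of `a` with elements of `J`, then it
depends on `{a, b} + J` only. -/
theorem eq_of_symm_of_exchange {f : Fin n → Fin n → Multiset (Fin n) → V'}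
    (hs : ∀ a b J, f a b J = f b a J) (hf : ∀ a b c J, f a b (c ::ₘ J) = f c b (a ::ₘ J))
    {a b a' b' : Fin n} {J J' : Multiset (Fin n)}
    (h : a ::ₘ b ::ₘ J = a' ::ₘ b' ::ₘ J') : f a b J = f a' b' J' := by
  have h1 : ∀ a {b b' : Fin n} {J J' : Multiset (Fin n)}, b ::ₘ J = b' ::ₘ J' →
      f a b J = f a b' J' := fun a _ _ _ _ h =>
    eq_of_exchange (g := f a) (fun b c J => by rw [hs a b, hf, hs c a]) h
  rcases Multiset.cons_eq_cons.1 h with ⟨rfl, h2⟩ | ⟨-, cs, e1, e2⟩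
  · exact h1 a h2
  · rw [h1 a e1, hs, h1 a' e2.symm]

theorem map_pick {f : Fin n → Fin n → Multiset (Fin n) → V} {φ : V → V'}
    (hs : ∀ a b J, φ (f a b J) = φ (f b a J))
    (hf : ∀ a b c J, φ (f a b (c ::ₘ J)) = φ (f c b (a ::ₘ J))) (a b : Fin n)
    (J : Multiset (Fin n)) : φ (pick f (a ::ₘ b ::ₘ J)) = φ (f a b J) := by
  rcases pick_cases f (a ::ₘ b ::ₘ J) with ⟨a', b', J', h, e⟩ | ⟨h, -⟩
  · rw [e]
    exact eq_of_symm_of_exchange (f := fun a b J => φ (f a b J)) hs hf h.symm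
  · exact absurd ⟨a, b, J, rfl⟩ h

end Pick

section Primitive

variable {n : ℕ} {V V' : Type} [AddCommGroup V] [Module ℝ V] [AddCommGroup V'] [Module ℝ V']
  (H : Fin n → Fin n → Jet n V)

/-- A primitive of `∂_J ξ`, for `J` of order at least `2`: minus a derivative of the Schouten
tensor. -/
def primXi (J : Multiset (Fin n)) : V := pick (fun a b J => -schou H a b J) J

/-- The linearized Christoffel symbol, corrected so as to be a primitive of `∂_a ∂_b ∂_J C_ρ`. -/
def christoffel (ρ a b : Fin n) (J : Multiset (Fin n)) : V :=
  (1 / 2 : ℝ) • (H b ρ (a ::ₘ J) + H a ρ (b ::ₘ J) - H a b (ρ ::ₘ J))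
    - (eta b ρ • primXi H (a ::ₘ J) + eta a ρ • primXi H (b ::ₘ J) - eta a b • primXi H (ρ ::ₘ J))

/-- A primitive of `∂_J C_ρ`, up to the ghosts of lowest order. -/
def primC (ρ : Fin n) (J : Multiset (Fin n)) : V :=
  pick (christoffel H ρ) J +
    if J.card = 1 then (J.map fun a => (1 / 2 : ℝ) • H a ρ 0).sum else 0

theorem primXi_le_one {J : Multiset (Fin n)} (hJ : J.card ≤ 1) : primXi H J = 0 :=
  pick_eq_zero _ hJ

theorem primC_zero (ρ : Fin n) : primC H ρ 0 = 0 := by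
  rw [primC, pick_eq_zero _ (by simp)]; simp

theorem primC_singleton (ρ a : Fin n) : primC H ρ (a ::ₘ 0) = (1 / 2 : ℝ) • H a ρ 0 := by
  rw [primC, pick_eq_zero _ (by simp)]; simp

theorem primC_cons_cons (ρ a b : Fin n) (J : Multiset (Fin n)) :
    primC H ρ (a ::ₘ b ::ₘ J) = pick (christoffel H ρ) (a ::ₘ b ::ₘ J) := by
  rw [primC, if_neg (by simp), add_zero]

variable {H}

section Quotient

variable {φ : V →ₗ[ℝ] V'}

/-- Modulo Cotton tensors, the primitive of `∂_a ∂_b ∂_J ξ` does not depend on choices. -/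
theorem map_primXi (hH : ∀ μ ν J, H μ ν J = H ν μ J) (hcott : ∀ α β μ J, φ (cott H α β μ J) = 0)
    (a b : Fin n) (J : Multiset (Fin n)) :
    φ (primXi H (a ::ₘ b ::ₘ J)) = -φ (schou H a b J) := by
  rw [primXi, map_pick (φ := φ), map_neg]
  · intro a b J; rw [schou_symm hH]
  · intro a b c J
    have := hcott b a c J
    rw [cott, map_sub, sub_eq_zero] at this
    rw [map_neg, map_neg, this]

/-- Modulo Weyl and Cotton tensors, the primitive of `∂_a ∂_b ∂_J C_ρ` does not depend on choices. -/
theorem map_pick_christoffel (hH : ∀ μ ν J, H μ ν J = H ν μ J)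
    (hcott : ∀ α β μ J, φ (cott H α β μ J) = 0) (hconf : ∀ α β γ δ J, φ (conf H α β γ δ J) = 0)
    (ρ a b : Fin n) (J : Multiset (Fin n)) :
    φ (pick (christoffel H ρ) (a ::ₘ b ::ₘ J)) = φ (christoffel H ρ a b J) := by
  rw [map_pick (φ := φ)]
  · intro a b J
    rw [christoffel, christoffel, hH a b, eta_comm a b]
    congr 1
    module
  · intro a b c J
    -- The difference of the two choices is minus the Weyl component `c a b ρ`.
    have h := hconf c a b ρ J
    simp only [conf, riem, map_sub, map_add, map_smul] at h
    simp only [christoffel, map_sub, map_add, map_smul, map_primXi hH hcott]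
    rw [Multiset.cons_swap a c, Multiset.cons_swap b c, Multiset.cons_swap ρ c,
      Multiset.cons_swap b a, Multiset.cons_swap ρ a, schou_symm hH a c]
    refine sub_eq_zero.1 (Eq.trans ?_ (neg_eq_zero.2 h))
    module

end Quotient

/-- Modulo Weyl and Cotton tensors, the primitives of `∂_J (∂_μ C_ν + ∂_ν C_μ + 2 η_{μν} ξ)` recover
`∂_J h_{μν}`. -/
theorem map_primitive_gauge {φ : V →ₗ[ℝ] V'} (hH : ∀ μ ν J, H μ ν J = H ν μ J)
    (hcott : ∀ α β μ J, φ (cott H α β μ J) = 0) (hconf : ∀ α β γ δ J, φ (conf H α β γ δ J) = 0)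
    (μ ν : Fin n) {J : Multiset (Fin n)} (hJ : J ≠ 0) :
    φ (primC H ν (μ ::ₘ J) + primC H μ (ν ::ₘ J) + (2 * eta μ ν) • primXi H J) = φ (H μ ν J) := by
  obtain ⟨a, ha⟩ := Multiset.exists_mem_of_ne_zero hJ
  obtain ⟨J, rfl⟩ := Multiset.exists_cons_of_mem ha
  rw [primC_cons_cons, primC_cons_cons, map_add, map_add,
    map_pick_christoffel hH hcott hconf, map_pick_christoffel hH hcott hconf, ← map_add, ← map_add]
  congr 1
  rw [christoffel, christoffel, hH μ a, hH ν a, hH ν μ, eta_comm ν μ, eta_comm a μ, eta_comm a ν]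
  module

section GaugeJet

variable {c : Fin n → Jet n V'} {x : Jet n V'} {φ : V →ₗ[ℝ] V'}

/-- The primitives of `∂_J ξ` are mapped to `∂_J ξ`. -/
theorem map_primXi_gauge (hn : 3 ≤ n) (hφ : ∀ μ ν J, φ (H μ ν J) = gauge c x μ ν J)
    {J : Multiset (Fin n)} (hJ : 2 ≤ J.card) : φ (primXi H J) = x J := by
  have e : (fun μ ν J => φ (H μ ν J)) = gauge c x := by funext μ ν J; exact hφ μ ν J
  rcases pick_cases (fun a b J => -schou H a b J) J with ⟨a, b, J', rfl, h⟩ | ⟨h, -⟩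
  · rw [primXi, h, map_neg, map_schou, e, schou_gauge c x hn, neg_neg]
  · obtain ⟨a, ha⟩ := Multiset.card_pos_iff_exists_mem.1 (by omega : 0 < J.card)
    obtain ⟨J, rfl⟩ := Multiset.exists_cons_of_mem ha
    rw [Multiset.card_cons] at hJ
    obtain ⟨b, hb⟩ := Multiset.card_pos_iff_exists_mem.1 (by omega : 0 < J.card)
    obtain ⟨J, rfl⟩ := Multiset.exists_cons_of_mem hb
    exact absurd ⟨a, b, J, rfl⟩ h

/-- The primitives of `∂_J C_ρ` are mapped to `∂_J C_ρ`, up to a subspace `T` which contains the ghosts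
of lowest order. -/
theorem map_primC_gauge (hn : 3 ≤ n) (hφ : ∀ μ ν J, φ (H μ ν J) = gauge c x μ ν J)
    (T : Submodule ℝ V') (hT0 : ∀ μ, c μ 0 ∈ T)
    (hT1 : ∀ μ ν, (1 / 2 : ℝ) • (c ν (μ ::ₘ 0) - c μ (ν ::ₘ 0)) ∈ T) (hx0 : x 0 ∈ T)
    (hx1 : ∀ μ, x (μ ::ₘ 0) ∈ T) (ρ : Fin n) (J : Multiset (Fin n)) :
    φ (primC H ρ J) - c ρ J ∈ T := by
  -- The Schouten correction cancels `∂_μ ∂_J ξ` unless `J = 0`.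
  have hx : ∀ μ J, x (μ ::ₘ J) - φ (primXi H (μ ::ₘ J)) ∈ T := by
    intro μ J
    rcases J.empty_or_exists_mem with rfl | ⟨a, ha⟩
    · rw [primXi_le_one _ (by simp), map_zero, sub_zero]; exact hx1 μ
    · obtain ⟨J, rfl⟩ := Multiset.exists_cons_of_mem ha
      rw [map_primXi_gauge hn hφ (by simp), sub_self]; exact zero_mem T
  rcases pick_cases (christoffel H ρ) J with ⟨a, b, J, rfl, h⟩ | ⟨h, -⟩
  · rw [primC_cons_cons, h, christoffel]
    have key : φ ((1 / 2 : ℝ) • (H b ρ (a ::ₘ J) + H a ρ (b ::ₘ J) - H a b (ρ ::ₘ J))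
        - (eta b ρ • primXi H (a ::ₘ J) + eta a ρ • primXi H (b ::ₘ J)
          - eta a b • primXi H (ρ ::ₘ J))) - c ρ (a ::ₘ b ::ₘ J) =
        eta b ρ • (x (a ::ₘ J) - φ (primXi H (a ::ₘ J))) +
        eta a ρ • (x (b ::ₘ J) - φ (primXi H (b ::ₘ J))) -
        eta a b • (x (ρ ::ₘ J) - φ (primXi H (ρ ::ₘ J))) := by
      simp only [map_sub, map_add, map_smul, hφ, gauge]
      rw [Multiset.cons_swap ρ a, Multiset.cons_swap ρ b, Multiset.cons_swap b a]
      module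
    rw [key]
    exact sub_mem (add_mem (T.smul_mem _ (hx a J)) (T.smul_mem _ (hx b J))) (T.smul_mem _ (hx ρ J))
  · rcases J.empty_or_exists_mem with rfl | ⟨a, ha⟩
    · rw [primC_zero, map_zero, zero_sub]; exact neg_mem (hT0 ρ)
    · obtain ⟨J, rfl⟩ := Multiset.exists_cons_of_mem ha
      rcases J.empty_or_exists_mem with rfl | ⟨b, hb⟩
      · rw [primC_singleton, map_smul, hφ, gauge]
        have : (1 / 2 : ℝ) • (c ρ (a ::ₘ 0) + c a (ρ ::ₘ 0) + (2 * eta a ρ) • x 0) - c ρ (a ::ₘ 0) =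
            eta a ρ • x 0 - (1 / 2 : ℝ) • (c ρ (a ::ₘ 0) - c a (ρ ::ₘ 0)) := by module
        rw [this]
        exact sub_mem (T.smul_mem _ hx0) (hT1 a ρ)
      · obtain ⟨J, rfl⟩ := Multiset.exists_cons_of_mem hb
        exact absurd ⟨a, b, J, rfl⟩ h

end GaugeJet

end Primitive

/-! ### The contraction of the local functions -/

section Fields

variable {n : ℕ} {R : Type} [CommRing R] [Algebra ℝ R] (coord : Sym2 (Fin n) → R)

theorem fieldH_symm (μ ν : Fin n) (J : Multiset (Fin n)) :
    fieldH coord μ ν J = fieldH coord ν μ J := by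
  simp only [fieldH, Sym2.eq_swap]

theorem fieldH_zero (μ ν : Fin n) : fieldH coord μ ν 0 = ofCoeff n (coord s(μ, ν)) := rfl

theorem fieldH_of_ne {J : Multiset (Fin n)} (hJ : J ≠ 0) (μ ν : Fin n) :
    fieldH coord μ ν J = ofEven R (.h J hJ s(μ, ν)) := dif_neg hJ

theorem riemann_apply (α β μ ν : Fin n) (J : Multiset (Fin n)) :
    riemann coord α β μ ν J = riem (fieldH coord) α β μ ν J := by
  simp only [riemann, riem, pd, Pi.smul_apply, Pi.sub_apply, Pi.add_apply]
  rw [Multiset.cons_swap μ α, Multiset.cons_swap ν β, Multiset.cons_swap ν α,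
    Multiset.cons_swap μ β]

theorem ricci_apply (μ ν : Fin n) (J : Multiset (Fin n)) :
    ricci coord μ ν J = ric (fieldH coord) μ ν J := by
  simp only [ricci, ric, Finset.sum_apply, Pi.smul_apply, riemann_apply]
  exact Finset.sum_congr rfl fun α _ => sum_eta_eta (fun l => riem (fieldH coord) l μ α ν J) α

theorem scalar_apply (J : Multiset (Fin n)) : scalar coord J = scal (fieldH coord) J := by
  simp only [scalar, scal, Finset.sum_apply, Pi.smul_apply, ricci_apply]
  exact Finset.sum_congr rfl fun α _ => sum_eta_eta (fun l => ric (fieldH coord) α l J) α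

theorem schouten_apply (μ ν : Fin n) (J : Multiset (Fin n)) :
    schouten coord μ ν J = schou (fieldH coord) μ ν J := by
  simp only [schouten, schou, Pi.smul_apply, Pi.sub_apply, ricci_apply, scalar_apply]

theorem weyl_apply (hn : 3 ≤ n) (α β γ δ : Fin n) (J : Multiset (Fin n)) :
    weyl coord α β γ δ J = conf (fieldH coord) α β γ δ J := by
  have hn' : (3 : ℝ) ≤ n := by exact_mod_cast hn
  have h1 : (n : ℝ) - 1 ≠ 0 := by linarith
  have h2 : (n : ℝ) - 2 ≠ 0 := by linarith
  have h3 : 1 / (((n : ℝ) - 2) * (n - 1)) = 2 * (1 / ((n : ℝ) - 2) * (1 / (2 * (n - 1)))) := by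
    field_simp
  simp only [weyl, conf, schou, Pi.smul_apply, Pi.sub_apply, Pi.add_apply, ricci_apply,
    scalar_apply, riemann_apply, h3]
  rw [eta_comm β γ, eta_comm δ α, eta_comm δ β, eta_comm γ α, eta_comm γ β, eta_comm β γ]
  module

theorem cotton_apply (α β μ : Fin n) (J : Multiset (Fin n)) :
    cotton coord α β μ J = cott (fieldH coord) α β μ J := by
  simp only [cotton, cott, Pi.sub_apply, pd, schouten_apply]

theorem riem_mem {V : Type} [AddCommGroup V] [Module ℝ V] {H : Fin n → Fin n → Jet n V}
    {T : Submodule ℝ V} (hT : ∀ μ ν a J, H μ ν (a ::ₘ J) ∈ T) (α β μ ν : Fin n)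
    (J : Multiset (Fin n)) : riem H α β μ ν J ∈ T :=
  T.smul_mem _ (sub_mem (sub_mem (add_mem (hT ..) (hT ..)) (hT ..)) (hT ..))

theorem schou_mem {V : Type} [AddCommGroup V] [Module ℝ V] {H : Fin n → Fin n → Jet n V}
    {T : Submodule ℝ V} (hT : ∀ μ ν a J, H μ ν (a ::ₘ J) ∈ T) (μ ν : Fin n)
    (J : Multiset (Fin n)) : schou H μ ν J ∈ T := by
  have hric : ∀ μ ν, ric H μ ν J ∈ T := fun μ ν =>
    sum_mem fun α _ => T.smul_mem _ (riem_mem hT ..)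
  exact T.smul_mem _ (sub_mem (hric μ ν) (T.smul_mem _ (sum_mem fun α _ => T.smul_mem _ (hric α α))))

theorem conf_mem {V : Type} [AddCommGroup V] [Module ℝ V] {H : Fin n → Fin n → Jet n V}
    {T : Submodule ℝ V} (hT : ∀ μ ν a J, H μ ν (a ::ₘ J) ∈ T) (α β γ δ : Fin n)
    (J : Multiset (Fin n)) : conf H α β γ δ J ∈ T :=
  sub_mem (riem_mem hT ..) (add_mem (sub_mem (sub_mem (T.smul_mem _ (schou_mem hT ..))
    (T.smul_mem _ (schou_mem hT ..))) (T.smul_mem _ (schou_mem hT ..)))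
    (T.smul_mem _ (schou_mem hT ..)))

theorem cott_mem {V : Type} [AddCommGroup V] [Module ℝ V] {H : Fin n → Fin n → Jet n V}
    {T : Submodule ℝ V} (hT : ∀ μ ν a J, H μ ν (a ::ₘ J) ∈ T) (α β μ : Fin n)
    (J : Multiset (Fin n)) : cott H α β μ J ∈ T :=
  sub_mem (schou_mem hT ..) (schou_mem hT ..)

theorem primXi_mem {V : Type} [AddCommGroup V] [Module ℝ V] {H : Fin n → Fin n → Jet n V}
    {T : Submodule ℝ V} (hT : ∀ μ ν J, H μ ν J ∈ T) (J : Multiset (Fin n)) :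
    primXi H J ∈ T := by
  rcases pick_cases (fun a b J => -schou H a b J) J with ⟨a, b, J', -, h⟩ | ⟨-, h⟩
  · rw [primXi, h]; exact neg_mem (schou_mem (fun μ ν a J => hT ..) ..)
  · rw [primXi, h]; exact zero_mem T

theorem primC_mem {V : Type} [AddCommGroup V] [Module ℝ V] {H : Fin n → Fin n → Jet n V}
    {T : Submodule ℝ V} (hT : ∀ μ ν J, H μ ν J ∈ T) (ρ : Fin n) (J : Multiset (Fin n)) :
    primC H ρ J ∈ T := by
  refine add_mem ?_ ?_
  · rcases pick_cases (christoffel H ρ) J with ⟨a, b, J', -, h⟩ | ⟨-, h⟩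
    · rw [h]
      exact sub_mem (T.smul_mem _ (sub_mem (add_mem (hT ..) (hT ..)) (hT ..)))
        (sub_mem (add_mem (T.smul_mem _ (primXi_mem hT _)) (T.smul_mem _ (primXi_mem hT _)))
          (T.smul_mem _ (primXi_mem hT _)))
    · rw [h]; exact zero_mem T
  · split_ifs
    · refine multiset_sum_mem _ fun x hx => ?_
      obtain ⟨a, -, rfl⟩ := Multiset.mem_map.1 hx
      exact T.smul_mem _ (hT ..)
    · exact zero_mem T

/-- The map from the anticommuting variables to the jets of `h_{μν}` which assigns to `∂_J ξ` and
`∂_J C_ρ` their primitives. -/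
def contraction : (OddVar n →₀ ℝ) →ₗ[ℝ] LocalFunction n R :=
  Finsupp.linearCombination ℝ fun v => match v with
    | .C J μ => primC (fieldH coord) μ J
    | .xi J => primXi (fieldH coord) J
    | .hstar _ _ => 0

theorem contraction_C (J : Multiset (Fin n)) (μ : Fin n) :
    contraction coord (Finsupp.single (.C J μ) 1) = primC (fieldH coord) μ J := by
  simp [contraction]

theorem contraction_xi (J : Multiset (Fin n)) :
    contraction coord (Finsupp.single (.xi J) 1) = primXi (fieldH coord) J := by
  simp [contraction]

theorem contraction_hstar (J : Multiset (Fin n)) (p : Sym2 (Fin n)) :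
    contraction coord (Finsupp.single (.hstar J p) 1) = 0 := by
  simp [contraction]

theorem contraction_gammaVec (μ ν : Fin n) (J : Multiset (Fin n)) :
    contraction coord (gammaVec s(μ, ν) J) = primC (fieldH coord) ν (μ ::ₘ J) +
      primC (fieldH coord) μ (ν ::ₘ J) + (2 * eta μ ν) • primXi (fieldH coord) J := by
  simp only [gammaVec, Sym2.lift_mk, map_add, map_smul, contraction_C, contraction_xi]

variable {coord}

theorem gamma_fieldH {par : Sym2 (Fin n) → Derivation ℝ R R}
    (hpar : ∀ p q, par p (coord q) = if p = q then 1 else 0) (μ ν : Fin n)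
    (J : Multiset (Fin n)) :
    gamma n par (fieldH coord μ ν J) =
      gauge (fun μ J => ofOdd R (oddC μ J)) (fun J => ofOdd R (oddXi J)) μ ν J := by
  have h : ofGrass R (gammaVec s(μ, ν) J) =
      gauge (fun μ J => ofOdd R (oddC μ J)) (fun J => ofOdd R (oddXi J)) μ ν J := by
    simp only [gammaVec, Sym2.lift_mk, map_add, map_smul]
    rfl
  rw [← h]
  by_cases hJ : J = 0
  · subst hJ
    rw [fieldH_zero, gamma_ofCoeff, Finset.sum_eq_single s(μ, ν)]
    · rw [hpar, if_pos rfl, ofCoeff, ← Algebra.TensorProduct.one_def, one_mul]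
    · intro p _ hp; rw [hpar, if_neg hp]; simp [ofCoeff]
    · simp
  · rw [fieldH_of_ne coord hJ, gamma_ofEven']
    rfl

theorem fieldH_mem_jets (μ ν : Fin n) (J : Multiset (Fin n)) : fieldH coord μ ν J ∈ jets coord := by
  by_cases hJ : J = 0
  · subst hJ
    exact Submodule.mem_sup_right (Submodule.subset_span ⟨_, rfl⟩)
  · rw [fieldH_of_ne coord hJ]
    exact Submodule.mem_sup_left (Submodule.subset_span ⟨J, hJ, _, rfl⟩)

theorem fieldH_mem_properJets (μ ν a : Fin n) (J : Multiset (Fin n)) :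
    fieldH coord μ ν (a ::ₘ J) ∈ properJets n R := by
  rw [fieldH_of_ne coord (Multiset.cons_ne_zero)]
  exact Submodule.subset_span ⟨_, _, _, rfl⟩

/-- If the span of the invariant jets `X` contains all Weyl and Cotton tensors, then `γ` has a
partial inverse up to `X`. -/
theorem isPartialInverse_contraction (hn : 3 ≤ n) {par : Sym2 (Fin n) → Derivation ℝ R R}
    (hpar : ∀ p q, par p (coord q) = if p = q then 1 else 0) {X : Set (LocalFunction n R)}
    (hX : X ⊆ properJets n R) (hγ : ∀ x ∈ X, gamma n par x = 0)
    (hconf : ∀ α β γ δ J, conf (fieldH coord) α β γ δ J ∈ Submodule.span ℝ X)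
    (hcott : ∀ α β μ J, cott (fieldH coord) α β μ J ∈ Submodule.span ℝ X) :
    IsPartialInverse coord par X (contraction coord) where
  X_subset := hX
  gamma_X := hγ
  K_mem m := by
    induction m using Finsupp.induction_linear with
    | zero => rw [map_zero]; exact zero_mem _
    | add a b ha hb => rw [map_add]; exact add_mem ha hb
    | single v c =>
      rw [← mul_one c, ← smul_eq_mul, ← Finsupp.smul_single, map_smul]
      refine Submodule.smul_mem _ _ ?_
      cases v with
      | C J μ => rw [contraction_C]; exact primC_mem fieldH_mem_jets ..
      | xi J => rw [contraction_xi]; exact primXi_mem fieldH_mem_jets ..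
      | hstar J p => rw [contraction_hstar]; exact zero_mem _
  K_eq_zero m hm := by
    rcases hm with ⟨μ, ν, J, rfl⟩ | (((⟨μ, rfl⟩ | ⟨μ, ν, rfl⟩) | rfl) | ⟨μ, rfl⟩)
    · exact contraction_hstar ..
    · rw [contraction_C, primC_zero]
    · rw [map_smul, map_sub, contraction_C, contraction_C, primC_singleton, primC_singleton,
        fieldH_symm, sub_self, smul_zero]
    · rw [contraction_xi, primXi_le_one _ (by simp)]
    · rw [contraction_xi, primXi_le_one _ (by simp)]
  gamma_K m := by
    set T := Submodule.span ℝ (antifields n R ∪ ghosts n R) with hT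
    have hφ := gamma_fieldH (coord := coord) hpar
    induction m using Finsupp.induction_linear with
    | zero => simp
    | add a b ha hb =>
      rw [map_add, map_add, map_add, add_sub_add_comm]; exact add_mem ha hb
    | single v c =>
      rw [← mul_one c, ← smul_eq_mul, ← Finsupp.smul_single, map_smul, map_smul, map_smul,
        ← smul_sub]
      refine Submodule.smul_mem _ _ ?_
      cases v with
      | C J μ =>
        rw [contraction_C]
        refine map_primC_gauge hn hφ T ?_ ?_ ?_ ?_ μ J
        · exact fun μ => Submodule.subset_span (.inr (.inl (.inl (.inl ⟨μ, rfl⟩))))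
        · refine fun μ ν => Submodule.subset_span (.inr (.inl (.inl (.inr ⟨μ, ν, ?_⟩))))
          simp only [ofOdd, Pi.smul_apply, Pi.sub_apply, pd, TensorProduct.tmul_smul,
            TensorProduct.tmul_sub]
        · exact Submodule.subset_span (.inr (.inl (.inr rfl)))
        · exact fun μ => Submodule.subset_span (.inr (.inr ⟨μ, rfl⟩))
      | xi J =>
        rw [contraction_xi]
        by_cases hJ : 2 ≤ J.card
        · rw [map_primXi_gauge hn hφ hJ]
          exact (sub_self (ofOdd R (oddXi J))).symm ▸ zero_mem T
        · rw [primXi_le_one _ (by omega), map_zero, zero_sub]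
          refine neg_mem (Submodule.subset_span ?_)
          rcases J.empty_or_exists_mem with rfl | ⟨a, ha⟩
          · exact .inr (.inl (.inr rfl))
          · obtain ⟨J, rfl⟩ := Multiset.exists_cons_of_mem ha
            have : J = 0 := by rw [Multiset.card_cons] at hJ; exact Multiset.card_eq_zero.1 (by omega)
            subst this
            exact .inr (.inr ⟨a, rfl⟩)
      | hstar J p =>
        rw [contraction_hstar, map_zero, zero_sub]
        induction p with | _ μ ν
        exact neg_mem (Submodule.subset_span (.inl (.inl (.inl ⟨μ, ν, J, rfl⟩))))
  K_gamma_zero p := by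
    induction p with | _ μ ν
    rw [contraction_gammaVec, primC_singleton, primC_singleton, primXi_le_one _ (by simp),
      fieldH_symm coord ν μ, fieldH_zero]
    module
  K_gamma J hJ p := by
    induction p with | _ μ ν
    rw [contraction_gammaVec, ← fieldH_of_ne coord hJ, ← Submodule.Quotient.eq]
    exact map_primitive_gauge (φ := (Submodule.span ℝ X).mkQ) (fieldH_symm coord)
      (fun α β μ J => (Submodule.Quotient.mk_eq_zero _).2 (hcott α β μ J))
      (fun α β γ δ J => (Submodule.Quotient.mk_eq_zero _).2 (hconf α β γ δ J)) μ ν hJ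

theorem gamma_conf (hn : 3 ≤ n) {par : Sym2 (Fin n) → Derivation ℝ R R}
    (hpar : ∀ p q, par p (coord q) = if p = q then 1 else 0) (α β γ δ : Fin n)
    (J : Multiset (Fin n)) : gamma n par (conf (fieldH coord) α β γ δ J) = 0 := by
  rw [map_conf]
  simp only [gamma_fieldH hpar]
  exact conf_gauge _ _ hn ..

theorem gamma_cott (hn : 3 ≤ n) {par : Sym2 (Fin n) → Derivation ℝ R R}
    (hpar : ∀ p q, par p (coord q) = if p = q then 1 else 0) (α β μ : Fin n)
    (J : Multiset (Fin n)) : gamma n par (cott (fieldH coord) α β μ J) = 0 := by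
  rw [map_cott]
  simp only [gamma_fieldH hpar]
  exact cott_gauge _ _ hn ..

/-- For `n ≥ 4` the Weyl tensors suffice: the Cotton tensor is a divergence of the Weyl tensor. -/
theorem isPartialInverse_weyl (hn : 4 ≤ n) {par : Sym2 (Fin n) → Derivation ℝ R R}
    (hpar : ∀ p q, par p (coord q) = if p = q then 1 else 0) :
    IsPartialInverse coord par {x | ∃ α β γ δ J, x = weyl coord α β γ δ J} (contraction coord) := by
  have hn3 : 3 ≤ n := by omega
  have hconf : ∀ α β γ δ J, conf (fieldH coord) α β γ δ J ∈
      Submodule.span ℝ {x | ∃ α β γ δ J, x = weyl coord α β γ δ J} := fun α β γ δ J =>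
    Submodule.subset_span ⟨α, β, γ, δ, J, (weyl_apply coord hn3 ..).symm⟩
  refine isPartialInverse_contraction hn3 hpar ?_ ?_ hconf ?_
  · rintro _ ⟨α, β, γ, δ, J, rfl⟩
    rw [weyl_apply coord hn3]
    exact conf_mem fieldH_mem_properJets ..
  · rintro _ ⟨α, β, γ, δ, J, rfl⟩
    rw [weyl_apply coord hn3]
    exact gamma_conf hn3 hpar ..
  · intro α β μ J
    have hn' : (4 : ℝ) ≤ n := by exact_mod_cast hn
    have h0 : (n : ℝ) - 3 ≠ 0 := by linarith
    have h := conf_div (fieldH_symm coord) hn3 α μ β J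
    rw [← inv_smul_smul₀ h0 (cott (fieldH coord) α β μ J), ← h]
    exact Submodule.smul_mem _ _ (sum_mem fun ρ _ =>
      Submodule.smul_mem _ _ (hconf ρ α μ β (ρ ::ₘ J)))

/-- For `n = 3` the Cotton tensors suffice: the Weyl tensor vanishes. -/
theorem isPartialInverse_cotton {R : Type} [CommRing R] [Algebra ℝ R] {coord : Sym2 (Fin 3) → R}
    {par : Sym2 (Fin 3) → Derivation ℝ R R}
    (hpar : ∀ p q, par p (coord q) = if p = q then 1 else 0) :
    IsPartialInverse coord par {x | ∃ α β μ J, x = cotton coord α β μ J} (contraction coord) := by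
  refine isPartialInverse_contraction le_rfl hpar ?_ ?_ ?_ ?_
  · rintro _ ⟨α, β, μ, J, rfl⟩
    rw [cotton_apply]
    exact cott_mem fieldH_mem_properJets ..
  · rintro _ ⟨α, β, μ, J, rfl⟩
    rw [cotton_apply]
    exact gamma_cott le_rfl hpar ..
  · intro α β γ δ J
    rw [conf_three (fieldH_symm coord)]
    exact zero_mem _
  · exact fun α β μ J => Submodule.subset_span ⟨α, β, μ, J, (cotton_apply coord ..).symm⟩

theorem cohomologyIsomorphicTo_weylFunctions (hn : 4 ≤ n) {par : Sym2 (Fin n) → Derivation ℝ R R}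
    {ev : R →ₐ[ℝ] ℝ} (hR : IsContractibleCoeff coord par ev) :
    CohomologyIsomorphicTo (gamma n par) (weylFunctions coord) :=
  (isPartialInverse_weyl hn hR.par_coord).cohomologyIsomorphicTo hR

theorem cohomologyIsomorphicTo_cottonFunctions {R : Type} [CommRing R] [Algebra ℝ R]
    {coord : Sym2 (Fin 3) → R} {par : Sym2 (Fin 3) → Derivation ℝ R R}
    {ev : R →ₐ[ℝ] ℝ} (hR : IsContractibleCoeff coord par ev) :
    CohomologyIsomorphicTo (gamma 3 par) (cottonFunctions coord) :=
  (isPartialInverse_cotton hR.par_coord).cohomologyIsomorphicTo hR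

end Fields

/-! ### Contractibility of the coefficients -/

section Polynomial

variable {n : ℕ}

theorem euler_monomial (m : Sym2 (Fin n) →₀ ℕ) (c : ℝ) :
    euler (polyCoord n) (polyPartial n) (MvPolynomial.monomial m c) =
      (m.degree : ℝ) • MvPolynomial.monomial m c := by
  rw [euler_apply]
  have := (MvPolynomial.isHomogeneous_monomial c (rfl : m.degree = m.degree)).sum_X_mul_pderiv
  rw [Nat.cast_smul_eq_nsmul]
  exact this

theorem coeff_euler (r : PolyCoeff n) (m : Sym2 (Fin n) →₀ ℕ) :
    (euler (polyCoord n) (polyPartial n) r).coeff m = (m.degree : ℝ) * r.coeff m := by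
  classical
  induction r using MvPolynomial.induction_on' with
  | monomial a b =>
    rw [euler_monomial, MvPolynomial.coeff_smul, MvPolynomial.coeff_monomial]
    split_ifs with h
    · subst h; rfl
    · simp
  | add p q hp hq => rw [map_add, MvPolynomial.coeff_add, MvPolynomial.coeff_add, hp, hq, mul_add]

theorem isContractibleCoeff_poly (n : ℕ) :
    IsContractibleCoeff (polyCoord n) (polyPartial n) (MvPolynomial.aeval fun _ => (0 : ℝ)) where
  par_comm p q r := by
    classical
    have h : ⁅polyPartial n p, polyPartial n q⁆ = 0 := MvPolynomial.derivation_ext fun i => by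
      simp only [polyPartial, Derivation.commutator_apply, MvPolynomial.pderiv_X, Pi.single_apply]
      split_ifs <;> simp
    have := Derivation.congr_fun h r
    rwa [Derivation.commutator_apply, Derivation.zero_apply, sub_eq_zero] at this
  par_coord p q := by
    classical
    exact (MvPolynomial.pderiv_X p q).trans (by rw [Pi.single_apply]; simp only [eq_comm])
  ev_coord p := by simp [polyCoord]
  euler_add_bijective k hk := by
    refine ⟨fun r s h => ?_, fun r => ?_⟩
    · ext m
      have h1 := congrArg (MvPolynomial.coeff m) h
      simp only [MvPolynomial.coeff_add, coeff_euler, MvPolynomial.coeff_smul, smul_eq_mul,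
        ← add_mul] at h1
      exact mul_left_cancel₀ (by positivity) h1
    · induction r using MvPolynomial.induction_on' with
      | monomial m c =>
        have h0 : (m.degree : ℝ) + k ≠ 0 := by positivity
        refine ⟨((m.degree : ℝ) + k)⁻¹ • MvPolynomial.monomial m c, ?_⟩
        dsimp only
        rw [Derivation.map_smul, euler_monomial, smul_comm (k : ℝ), ← smul_add, ← add_smul, inv_smul_smul₀ h0]
      | add p q hp hq =>
        obtain ⟨p', rfl⟩ := hp
        obtain ⟨q', rfl⟩ := hq
        refine ⟨p' + q', ?_⟩
        dsimp only
        rw [map_add, smul_add]; abel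
  euler_ker r hr := by
    classical
    ext m
    rw [MvPolynomial.algebraMap_eq, MvPolynomial.coeff_C]
    split_ifs with h
    · subst h
      simp [MvPolynomial.constantCoeff_eq]
    · have h1 := congrArg (MvPolynomial.coeff m) hr
      rw [coeff_euler, MvPolynomial.coeff_zero] at h1
      refine (mul_eq_zero.1 h1).resolve_left ?_
      rw [Nat.cast_eq_zero, Finsupp.degree_eq_zero_iff]
      exact Ne.symm h
  euler_range r := by
    induction r using MvPolynomial.induction_on' with
    | monomial m c =>
      by_cases hm : m = 0
      · subst hm
        exact ⟨0, by simp [MvPolynomial.algebraMap_eq]⟩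
      · have h0 : (m.degree : ℝ) ≠ 0 := by
          rw [Nat.cast_ne_zero, Ne, Finsupp.degree_eq_zero_iff]; exact hm
        refine ⟨(m.degree : ℝ)⁻¹ • MvPolynomial.monomial m c, ?_⟩
        rw [Derivation.map_smul, euler_monomial, inv_smul_smul₀ h0]
        have : MvPolynomial.aeval (fun _ : Sym2 (Fin n) => (0 : ℝ)) (MvPolynomial.monomial m c) = 0 := by
          simp [MvPolynomial.constantCoeff_monomial, hm]
        rw [this, map_zero, sub_zero]
    | add p q hp hq =>
      obtain ⟨p', hp⟩ := hp
      obtain ⟨q', hq⟩ := hq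
      exact ⟨p' + q', by rw [map_add, hp, hq, map_add, map_add]; abel⟩

end Polynomial

section Analysis

open MeasureTheory

variable {E : Type} [NormedAddCommGroup E] [NormedSpace ℝ E]

/-- The mean `∫₀¹ t^k g(t x) dt` along the ray through `x`. -/
def rayMean {F : Type} [NormedAddCommGroup F] [NormedSpace ℝ F] (k : ℕ) (g : E → F) (x : E) : F :=
  ∫ t in (0 : ℝ)..1, t ^ k • g (t • x)

theorem hasFDerivAt_rayMean [ProperSpace E] {F : Type} [NormedAddCommGroup F] [NormedSpace ℝ F]
    (k : ℕ) {g : E → F} (hg : ContDiff ℝ 1 g) (x : E) :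
    HasFDerivAt (rayMean k g) (rayMean (k + 1) (fderiv ℝ g) x) x := by
  have hg' : Continuous (fderiv ℝ g) := hg.continuous_fderiv (by simp)
  have hgc := hg.continuous
  obtain ⟨B, hB⟩ := (isCompact_closedBall (0 : E) (‖x‖ + 1)).exists_bound_of_continuousOn
    hg'.continuousOn
  refine intervalIntegral.hasFDerivAt_integral_of_dominated_of_fderiv_le
    (F := fun x t => t ^ k • g (t • x)) (F' := fun x t => t ^ (k + 1) • fderiv ℝ g (t • x))
    (bound := fun _ => B) (Metric.ball_mem_nhds x one_pos) ?_ ?_ ?_ ?_ ?_ ?_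
  · exact .of_forall fun y => (by fun_prop : Continuous fun t : ℝ => t ^ k • g (t • y)).aestronglyMeasurable
  · exact (by fun_prop : Continuous fun t : ℝ => t ^ k • g (t • x)).intervalIntegrable _ _
  · exact (by fun_prop : Continuous fun t : ℝ => t ^ (k + 1) • fderiv ℝ g (t • x)).aestronglyMeasurable
  · refine .of_forall fun t ht y hy => ?_
    rw [Set.uIoc_of_le zero_le_one] at ht
    have h1 : ‖t‖ ≤ 1 := by rw [Real.norm_eq_abs, abs_of_pos ht.1]; exact ht.2
    have h2 : ‖y‖ ≤ ‖x‖ + 1 := by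
      have := norm_le_norm_add_norm_sub' y x
      rw [Metric.mem_ball, dist_eq_norm] at hy
      linarith
    have h3 : t • y ∈ Metric.closedBall (0 : E) (‖x‖ + 1) := by
      rw [mem_closedBall_zero_iff, norm_smul]
      exact (mul_le_of_le_one_left (norm_nonneg y) h1).trans h2
    rw [norm_smul, norm_pow]
    exact (mul_le_of_le_one_left (norm_nonneg _) (pow_le_one₀ (norm_nonneg t) h1)).trans (hB _ h3)
  · exact intervalIntegrable_const
  · refine .of_forall fun t _ y _ => ?_
    have h1 : HasFDerivAt (fun y : E => t • y) (t • ContinuousLinearMap.id ℝ E) y :=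
      (hasFDerivAt_id y).const_smul t
    have h2 := (((hg.differentiable (by simp)).differentiableAt (x := t • y)).hasFDerivAt.comp y
      h1).const_smul (t ^ k)
    have h3 : t ^ (k + 1) • fderiv ℝ g (t • y) =
        t ^ k • (fderiv ℝ g (t • y)).comp (t • ContinuousLinearMap.id ℝ E) := by
      ext z
      simp [pow_succ, smul_smul]
    rw [h3]
    exact h2

/-- Differentiation raises the exponent `k` and replaces the function by its derivative, so that the
smoothness of the means follows by induction for all exponents and targets at once. -/
theorem contDiff_rayMean [ProperSpace E] (m : ℕ) : ∀ {F : Type} [NormedAddCommGroup F]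
    [NormedSpace ℝ F] (k : ℕ) {g : E → F}, ContDiff ℝ ∞ g → ContDiff ℝ m (rayMean k g) := by
  induction m with
  | zero =>
    intro F _ _ k g hg
    have h1 := fun x => (hasFDerivAt_rayMean k (hg.of_le (by simp)) x).continuousAt
    exact contDiff_zero.2 (continuous_iff_continuousAt.2 h1)
  | succ m ih =>
    intro F _ _ k g hg
    have h1 := hasFDerivAt_rayMean k (hg.of_le (by simp) : ContDiff ℝ 1 g)
    push_cast
    rw [contDiff_succ_iff_fderiv]
    refine ⟨fun x => (h1 x).differentiableAt, by simp, ?_⟩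
    have : fderiv ℝ (rayMean k g) = rayMean (k + 1) (fderiv ℝ g) := funext fun x => (h1 x).fderiv
    rw [this]
    exact ih (k + 1) (hg.fderiv_right (by simp))

theorem hasDerivAt_pow_smul_ray {f : E → ℝ} (hf : ContDiff ℝ ∞ f) (k : ℕ) (x : E) (t : ℝ) :
    HasDerivAt (fun t : ℝ => t ^ k * f (t • x))
      (k * t ^ (k - 1) * f (t • x) + t ^ k * fderiv ℝ f (t • x) x) t := by
  have h1 : HasDerivAt (fun t : ℝ => t • x) x t := by
    simpa using (hasDerivAt_id t).smul_const x
  exact (hasDerivAt_pow k t).mul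
    (((hf.differentiable (by simp)).differentiableAt (x := t • x)).hasFDerivAt.comp_hasDerivAt t h1)

/-- `(E + k) ∫₀¹ t^(k-1) f(t x) dt = f(x)` for the Euler operator `E`. -/
theorem fderiv_rayMean_add [ProperSpace E] {f : E → ℝ} (hf : ContDiff ℝ ∞ f) (k : ℕ) (x : E) :
    fderiv ℝ (rayMean k f) x x + (k + 1 : ℕ) * rayMean k f x = f x := by
  have hf' : Continuous (fderiv ℝ f) := hf.continuous_fderiv (by simp)
  have hfc := hf.continuous
  have c1 : Continuous fun t : ℝ => t ^ (k + 1) • fderiv ℝ f (t • x) := by fun_prop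
  have c2 : Continuous fun t : ℝ => t ^ k • f (t • x) := by fun_prop
  have c3 : Continuous fun t : ℝ => t ^ (k + 1) * fderiv ℝ f (t • x) x := by fun_prop
  have h1 := intervalIntegral.integral_eq_sub_of_hasDerivAt (a := 0) (b := 1)
    (fun t _ => hasDerivAt_pow_smul_ray hf (k + 1) x t)
    (Continuous.intervalIntegrable (by fun_prop) _ _)
  rw [(hasFDerivAt_rayMean k (hf.of_le (by simp)) x).fderiv, rayMean, rayMean,
    ContinuousLinearMap.intervalIntegral_apply (c1.intervalIntegrable _ _),
    ← intervalIntegral.integral_const_mul]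
  simp only [smul_apply, smul_eq_mul] at c2 ⊢
  rw [← intervalIntegral.integral_add
      (c3.intervalIntegrable _ _) ((c2.intervalIntegrable _ _).const_mul _)]
  simp only [one_pow, one_smul, one_mul, ne_eq, Nat.add_eq_zero_iff, one_ne_zero, and_false,
    not_false_eq_true, zero_pow, zero_mul, sub_zero] at h1
  rw [← h1]
  refine intervalIntegral.integral_congr fun t _ => ?_
  simp [mul_assoc, add_comm]

/-- Hadamard's lemma: `f(x) - f(0)` is linear in `x` with smooth coefficients. -/
theorem sub_eq_rayMean_fderiv [ProperSpace E] {f : E → ℝ} (hf : ContDiff ℝ ∞ f) (x : E) :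
    f x - f 0 = rayMean 0 (fderiv ℝ f) x x := by
  have hf' : Continuous (fderiv ℝ f) := hf.continuous_fderiv (by simp)
  have c1 : Continuous fun t : ℝ => t ^ 0 • fderiv ℝ f (t • x) := by fun_prop
  have h1 := intervalIntegral.integral_eq_sub_of_hasDerivAt (a := 0) (b := 1)
    (fun t _ => hasDerivAt_pow_smul_ray hf 0 x t)
    (Continuous.intervalIntegrable (by fun_prop) _ _)
  rw [rayMean, ContinuousLinearMap.intervalIntegral_apply (c1.intervalIntegrable _ _)]
  simpa using h1.symm

/-- `E + k` is injective for `k ≥ 1`: if `(E + k) f = 0` then `t^k f(t x)` is constant in `t`. -/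
theorem eq_zero_of_euler_add {f : E → ℝ} (hf : ContDiff ℝ ∞ f) {k : ℕ} (hk : 1 ≤ k)
    (h : ∀ x, fderiv ℝ f x x + k * f x = 0) (x : E) : f x = 0 := by
  have h1 : ∀ t : ℝ, HasDerivAt (fun t : ℝ => t ^ k * f (t • x)) 0 t := by
    intro t
    convert hasDerivAt_pow_smul_ray hf k x t using 1
    obtain ⟨k, rfl⟩ : ∃ j, k = j + 1 := ⟨k - 1, by omega⟩
    have := h (t • x)
    rw [map_smul, smul_eq_mul] at this
    rw [Nat.add_sub_cancel, pow_succ]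
    linear_combination (-t ^ k) * this
  have h2 := is_const_of_deriv_eq_zero (fun t => (h1 t).differentiableAt) (fun t => (h1 t).deriv) 1 0
  simpa [show k ≠ 0 by omega] using h2

theorem eq_const_of_euler {f : E → ℝ} (hf : ContDiff ℝ ∞ f)
    (h : ∀ x, fderiv ℝ f x x = 0) (x : E) : f x = f 0 := by
  have hf' : Continuous (fderiv ℝ f) := hf.continuous_fderiv (by simp)
  -- The derivative along the ray vanishes away from the origin, hence there by continuity.
  have h0 : (fun t : ℝ => fderiv ℝ f (t • x) x) = fun _ => 0 := by
    refine Continuous.ext_on (dense_compl_singleton (0 : ℝ)) (by fun_prop) continuous_const ?_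
    intro t ht
    have := h (t • x)
    rw [map_smul, smul_eq_mul] at this
    exact (mul_eq_zero.1 this).resolve_left ht
  have h1 : ∀ t : ℝ, HasDerivAt (fun t : ℝ => t ^ 0 * f (t • x)) 0 t := by
    intro t
    convert hasDerivAt_pow_smul_ray hf 0 x t using 1
    rw [congrFun h0 t]; simp
  have h2 := is_const_of_deriv_eq_zero (fun t => (h1 t).differentiableAt) (fun t => (h1 t).deriv) 1 0
  simpa using h2

end Analysis

section Smooth

variable {n : ℕ}

/-- The evaluation of smooth functions at the origin. -/
def evalOrigin (n : ℕ) : SmoothCoeff n →ₐ[ℝ] ℝ :=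
  (Pi.evalAlgHom ℝ (fun _ : Sym2 (Fin n) → ℝ => ℝ) 0).comp (smoothFunctions n).val

theorem SmoothCoeff.contDiff (f : SmoothCoeff n) : ContDiff ℝ ∞ f.1 := mem_smoothFunctions.1 f.2

theorem sum_mul_fderiv_single (L : (Sym2 (Fin n) → ℝ) →L[ℝ] ℝ) (x : Sym2 (Fin n) → ℝ) :
    ∑ p, x p * L (Pi.single p 1) = L x := by
  have h : x = ∑ p, x p • (Pi.single p 1 : Sym2 (Fin n) → ℝ) := pi_eq_sum_univ' x
  conv_rhs => rw [h, map_sum]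
  simp only [map_smul, smul_eq_mul]

theorem euler_smooth (f : SmoothCoeff n) (x : Sym2 (Fin n) → ℝ) :
    (euler (smoothCoord n) (smoothPartial n) f).1 x = fderiv ℝ f.1 x x := by
  rw [euler_apply, ← sum_mul_fderiv_single (fderiv ℝ f.1 x) x]
  change (smoothFunctions n).val _ x = _
  rw [map_sum, Finset.sum_apply]
  rfl

theorem contDiff_top_rayMean {F : Type} [NormedAddCommGroup F] [NormedSpace ℝ F] (k : ℕ)
    {g : (Sym2 (Fin n) → ℝ) → F} (hg : ContDiff ℝ ∞ g) : ContDiff ℝ ∞ (rayMean k g) :=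
  contDiff_infty.2 fun m => contDiff_rayMean m k hg

theorem smooth_par_coord (p q : Sym2 (Fin n)) :
    smoothPartial n p (smoothCoord n q) = if p = q then 1 else 0 := by
  apply Subtype.ext
  funext x
  change fderiv ℝ (fun x : Sym2 (Fin n) → ℝ => x q) x (Pi.single p 1) = _
  rw [(hasFDerivAt_apply q x).fderiv]
  rw [ContinuousLinearMap.proj_apply, Pi.single_apply]
  simp only [eq_comm (a := q)]
  split_ifs <;> rfl

theorem smooth_euler_add_bijective {k : ℕ} (hk : 1 ≤ k) :
    Function.Bijective fun r : SmoothCoeff n =>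
      euler (smoothCoord n) (smoothPartial n) r + (k : ℝ) • r := by
  constructor
  · intro r s h
    rw [← sub_eq_zero]
    have h1 : euler (smoothCoord n) (smoothPartial n) (r - s) + (k : ℝ) • (r - s) = 0 := by
      rw [map_sub, smul_sub, ← add_sub_add_comm]
      exact sub_eq_zero.2 h
    apply Subtype.ext
    funext x
    refine eq_zero_of_euler_add (r - s).contDiff hk (fun x => ?_) x
    rw [← euler_smooth]
    exact congrFun (congrArg Subtype.val h1) x
  · intro r
    obtain ⟨k, rfl⟩ : ∃ j, k = j + 1 := ⟨k - 1, by omega⟩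
    refine ⟨⟨rayMean k r.1, mem_smoothFunctions.2 (contDiff_top_rayMean k r.contDiff)⟩, ?_⟩
    apply Subtype.ext
    funext x
    refine Eq.trans ?_ (fderiv_rayMean_add r.contDiff k x)
    refine congrArg (· + _) (euler_smooth _ x)

theorem isContractibleCoeff_smooth (n : ℕ) :
    IsContractibleCoeff (smoothCoord n) (smoothPartial n) (evalOrigin n) where
  par_comm p q r := by
    apply Subtype.ext
    funext x
    have hd : Differentiable ℝ (fderiv ℝ r.1) :=
      (r.contDiff.fderiv_right (m := ∞) (by simp)).differentiable (by simp)
    have h1 : ∀ u v : Sym2 (Fin n) → ℝ, fderiv ℝ (fun y => fderiv ℝ r.1 y u) x v =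
        fderiv ℝ (fderiv ℝ r.1) x v u := fun u v => by
      rw [fderiv_clm_apply hd.differentiableAt (differentiableAt_const u)]
      simp
    change fderiv ℝ (fun y => fderiv ℝ r.1 y (Pi.single q 1)) x (Pi.single p 1) =
      fderiv ℝ (fun y => fderiv ℝ r.1 y (Pi.single p 1)) x (Pi.single q 1)
    rw [h1, h1]
    exact (r.contDiff.contDiffAt.isSymmSndFDerivAt
      (by rw [minSmoothness_of_isRCLikeNormedField]; exact WithTop.coe_le_coe.2 (le_top : (2 : ℕ∞) ≤ ⊤))).eq _ _
  par_coord := smooth_par_coord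
  ev_coord p := rfl
  euler_add_bijective k hk := smooth_euler_add_bijective hk
  euler_ker r hr := by
    apply Subtype.ext
    funext x
    refine eq_const_of_euler r.contDiff (fun x => ?_) x
    rw [← euler_smooth, hr]; rfl
  euler_range r := by
    have hg := contDiff_top_rayMean 0 (r.contDiff.fderiv_right (m := ∞) (by simp))
    let g : Sym2 (Fin n) → SmoothCoeff n := fun p =>
      ⟨fun x => rayMean 0 (fderiv ℝ r.1) x (Pi.single p 1),
        mem_smoothFunctions.2 (hg.clm_apply contDiff_const)⟩
    have h1 : r - algebraMap ℝ _ (evalOrigin n r) = ∑ p, smoothCoord n p * g p := by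
      apply Subtype.ext
      funext x
      refine (sub_eq_rayMean_fderiv r.contDiff x).trans ?_
      rw [← sum_mul_fderiv_single]
      change _ = (smoothFunctions n).val _ x
      rw [map_sum, Finset.sum_apply]
      rfl
    have h2 : ∀ p, euler (smoothCoord n) (smoothPartial n) (smoothCoord n p) = smoothCoord n p := by
      intro p
      rw [euler_apply, Finset.sum_eq_single p]
      · rw [smooth_par_coord, if_pos rfl, mul_one]
      · intro q _ hq; rw [smooth_par_coord, if_neg hq, mul_zero]
      · simp
    choose u hu using fun p => (smooth_euler_add_bijective (n := n) le_rfl).2 (g p)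
    -- If `(E + 1) u_p = g_p`, then `E (h_p u_p) = h_p g_p`.
    refine ⟨∑ p, smoothCoord n p * u p, ?_⟩
    rw [h1, map_sum]
    refine Finset.sum_congr rfl fun p _ => ?_
    rw [← hu p, Derivation.leibniz, h2, smul_eq_mul, smul_eq_mul]
    dsimp only
    rw [Nat.cast_one, one_smul]
    ring

end Smooth

end LinWeyl

end

theorem mainTheorem6 :
    (∀ n : ℕ, 4 ≤ n →
      LinWeyl.CohomologyIsomorphicTo (LinWeyl.gamma n (LinWeyl.smoothPartial n))
        (LinWeyl.weylFunctions (LinWeyl.smoothCoord n)) ∧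
      LinWeyl.CohomologyIsomorphicTo (LinWeyl.gamma n (LinWeyl.polyPartial n))
        (LinWeyl.weylFunctions (LinWeyl.polyCoord n))) ∧
    (LinWeyl.CohomologyIsomorphicTo (LinWeyl.gamma 3 (LinWeyl.smoothPartial 3))
        (LinWeyl.cottonFunctions (LinWeyl.smoothCoord 3)) ∧
      LinWeyl.CohomologyIsomorphicTo (LinWeyl.gamma 3 (LinWeyl.polyPartial 3))
        (LinWeyl.cottonFunctions (LinWeyl.polyCoord 3))) :=
  ⟨fun n hn =>
    ⟨LinWeyl.cohomologyIsomorphicTo_weylFunctions hn (LinWeyl.isContractibleCoeff_smooth n),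
      LinWeyl.cohomologyIsomorphicTo_weylFunctions hn (LinWeyl.isContractibleCoeff_poly n)⟩,
    LinWeyl.cohomologyIsomorphicTo_cottonFunctions (LinWeyl.isContractibleCoeff_smooth 3),
    LinWeyl.cohomologyIsomorphicTo_cottonFunctions (LinWeyl.isContractibleCoeff_poly 3)⟩
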